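/- Let $\mathcal N$ be a random $n\times p$ matrix with i.i.d. standard Gaussian entries (mean zero, variance one), let $D=\mathrm{diag}(\sigma_1,\dots,\sigma_p)$ with all $\sigma_k>0$, let $P$ be a $p\times p$ orthogonal matrix, and put $$\Sigma=P^TD^2P,\qquad X=\mathcal N DP,\qquad \hat\Sigma=\tfrac1n X^TX=P^TD\,\frac{\mathcal N^T\mathcal N}{n}\,DP .$$ Write $\sigma_{\max}=\max_k\sigma_k$, $\sigma_{\min}=\min_k\sigma_k$, let $\mathbb 1\in\mathbb R^p$ be the all-ones vector, and let $S_\Sigma=\Sigma^{-1}\mathbb 1$ and $S_{\hat\Sigma}=\hat\Sigma^{-1}\mathbb 1$ be the true and the sample free optimal weight of the minimum-variance portfolio. Fix $\gamma\in(0,1)$ and consider the dimensions $1\le p\le\gamma n$. 1. For every $A>0$ there is a constant $C=C(\gamma,A)>0$ such that for all such $n,p$, all $\sigma_1,\dots,\sigma_p>0$ and all orthogonal $P$, with probability at least $1-e^{-Ap}$ the matrix $\hat\Sigma$ is invertible and $$\|S_{\hat\Sigma}-S_\Sigma\|_2\;\le\;C\,\|S_\Sigma\|_2\,\frac{\sigma_{\max}}{\sigma_{\min}}\sqrt{\frac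 pn}.\qquad(*)$$ 2. For all $a,c>0$ there is a constant $C=C(\gamma,a,c)>0$ such that, if moreover $p\ge a\log n$, then with probability at least $1-n^{-c}$ the matrix $\hat\Sigma$ is invertible and $(*)$ holds. 3. There are $C=C(\gamma)>0$ and $n_0=n_0(\gamma)$ such that for all $n\ge n_0$, $1\le p\le\gamma n$, all $\sigma_1,\dots,\sigma_p>0$ and all orthogonal $P$, the matrix $\hat\Sigma$ is almost surely invertible, $\|S_{\hat\Sigma}-S_\Sigma\|_2$ is integrable, and $$\mathbb E\|S_{\hat\Sigma}-S_\Sigma\|_2\le C\,\|S_\Sigma\|_2\,\frac{\sigma_{\max}}{\sigma_{\min}}\sqrt{\frac pn}\qquad\text{and}\qquad \mathbb E\|S_{\hat\Sigma}-S_\Sigma\|_2\le \frac{C}{\sigma_{\min}^{2}}\;p\,\frac{\sigma_{\max}}{\sigma_{\min}}\sqrt{\frac pn}.$$ -/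

import Mathlib

open MeasureTheory ProbabilityTheory Matrix

namespace MinVarPortfolio

noncomputable section

/-- The random `n × p` matrix `N` has i.i.d. standard Gaussian entries under `μ`. -/
def IsStdGaussianMatrix {Ω : Type*} [MeasurableSpace Ω] (μ : Measure Ω) {n p : ℕ}
    (N : Ω → Matrix (Fin n) (Fin p) ℝ) : Prop :=
  (∀ i j, HasLaw (fun ω => N ω i j) (gaussianReal 0 1) μ) ∧
    iIndepFun (fun (ij : Fin n × Fin p) (ω : Ω) => N ω ij.1 ij.2) μ

/-- The true covariance `Σ = Pᵀ D² P`, where `D = diag(σ₁, …, σ_p)`. -/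
def trueCov {p : ℕ} (σ : Fin p → ℝ) (P : Matrix (Fin p) (Fin p) ℝ) : Matrix (Fin p) (Fin p) ℝ :=
  Pᵀ * diagonal σ ^ 2 * P

/-- The data matrix (asset returns) `X = N D P`. -/
def dataMatrix {n p : ℕ} (σ : Fin p → ℝ) (P : Matrix (Fin p) (Fin p) ℝ)
    (N : Matrix (Fin n) (Fin p) ℝ) : Matrix (Fin n) (Fin p) ℝ :=
  N * diagonal σ * P

/-- The sample covariance `Xᵀ X / n` of an `n × p` data matrix `X`. -/
def sampleCov {n p : ℕ} (X : Matrix (Fin n) (Fin p) ℝ) : Matrix (Fin p) (Fin p) ℝ :=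
  (1 / (n : ℝ)) • (Xᵀ * X)

/-- For `X = N D P`, the sample covariance is `Pᵀ D (Nᵀ N / n) D P`. -/
theorem sampleCov_dataMatrix {n p : ℕ} (σ : Fin p → ℝ) (P : Matrix (Fin p) (Fin p) ℝ)
    (N : Matrix (Fin n) (Fin p) ℝ) :
    sampleCov (dataMatrix σ P N) =
      Pᵀ * diagonal σ * ((1 / (n : ℝ)) • (Nᵀ * N)) * diagonal σ * P := by
  simp [sampleCov, dataMatrix, Matrix.transpose_mul, Matrix.mul_assoc]

/-- The free optimal weight `S_A = A⁻¹ 𝟙` of a covariance matrix `A`, as a vector of Euclidean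
space (so that its norm is the 2-norm). -/
def freeWeight {p : ℕ} (A : Matrix (Fin p) (Fin p) ℝ) : EuclideanSpace ℝ (Fin p) :=
  WithLp.toLp 2 (A⁻¹ *ᵥ (fun _ => 1))

/-- The ratio `σ_max / σ_min` of the largest to the smallest of `σ₁, …, σ_p` (`p ≥ 1`). -/
def sigmaRatio {p : ℕ} (σ : Fin p → ℝ) : ℝ := (⨆ k, σ k) / (⨅ k, σ k)

end

end MinVarPortfolio

namespace MinVarPortfolio

/-- The `n × p` matrix with entries `e (i, j)`. -/
def toMat {n p : ℕ} (e : Fin n × Fin p → ℝ) : Matrix (Fin n) (Fin p) ℝ :=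
  Matrix.of fun i j => e (i, j)

/-- The law of the entries of an `n × p` standard Gaussian matrix. -/
noncomputable def stdGaussianEntries (n p : ℕ) : Measure (Fin n × Fin p → ℝ) :=
  Measure.pi fun _ => gaussianReal 0 1

instance (n p : ℕ) : IsProbabilityMeasure (stdGaussianEntries n p) := by
  unfold stdGaussianEntries; infer_instance

theorem IsStdGaussianMatrix.hasLaw {Ω : Type*} [MeasurableSpace Ω] {μ : Measure Ω} {n p : ℕ}
    {N : Ω → Matrix (Fin n) (Fin p) ℝ} (h : IsStdGaussianMatrix μ N) :
    HasLaw (fun ω (ij : Fin n × Fin p) => N ω ij.1 ij.2) (stdGaussianEntries n p) μ :=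
  iIndepFun.hasLaw_pi (fun ij => h.1 ij.1 ij.2) h.2

theorem toMat_apply_eq {n p : ℕ} (M : Matrix (Fin n) (Fin p) ℝ) :
    toMat (fun ij => M ij.1 ij.2) = M := rfl

theorem lintegral_exp_mul_sq_gaussianReal (v : NNReal) {θ : ℝ} (h : 2 * θ * v < 1) :
    ∫⁻ y, ENNReal.ofReal (Real.exp (θ * y ^ 2)) ∂(gaussianReal 0 v) =
      ENNReal.ofReal ((√(1 - 2 * θ * v))⁻¹) := by
  by_cases hv : v = 0
  · simp [hv]
  have hv' : (0 : ℝ) < v := by positivity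
  rw [gaussianReal_of_var_ne_zero _ hv, lintegral_withDensity_eq_lintegral_mul _
    (measurable_gaussianPDF 0 v) (by fun_prop)]
  have hb : 0 < 1 / (2 * (v : ℝ)) - θ := by
    rw [sub_pos, lt_div_iff₀ (by positivity)]; linarith
  have h1 : ∀ y : ℝ, (gaussianPDF 0 v * fun y => ENNReal.ofReal (Real.exp (θ * y ^ 2))) y =
      ENNReal.ofReal ((√(2 * Real.pi * v))⁻¹ * Real.exp (-(1 / (2 * (v : ℝ)) - θ) * y ^ 2)) := by
    intro y
    rw [Pi.mul_apply, gaussianPDF_def, gaussianPDFReal_def, ← ENNReal.ofReal_mul (by positivity),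
      mul_assoc, ← Real.exp_add]
    congr 3
    field_simp
    ring
  simp_rw [h1]
  rw [← ofReal_integral_eq_lintegral_ofReal ((integrable_exp_neg_mul_sq hb).const_mul _)
    (ae_of_all _ fun _ => by positivity), integral_const_mul, integral_gaussian]
  congr 1
  rw [← Real.sqrt_inv, ← Real.sqrt_inv, ← Real.sqrt_mul (by positivity)]
  congr 1
  have : 1 - 2 * θ * v ≠ 0 := by linarith
  have h2 : 1 / (2 * (v : ℝ)) - θ = (1 - 2 * θ * v) / (2 * v) := by field_simp
  rw [h2]
  field_simp

theorem continuous_toMat_mulVec {n p : ℕ} (x : Fin p → ℝ) :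
    Continuous fun e : Fin n × Fin p → ℝ => toMat e *ᵥ x := by
  refine continuous_pi fun i => ?_
  simp only [toMat, mulVec, dotProduct, Matrix.of_apply]
  fun_prop

theorem map_mulVec_stdGaussianEntries {n p : ℕ} (x : EuclideanSpace ℝ (Fin p)) :
    (stdGaussianEntries n p).map (fun e => toMat e *ᵥ x.ofLp) =
      Measure.pi fun _ => gaussianReal 0 (‖x‖₊ ^ 2) := by
  have hf := (continuous_toMat_mulVec (n := n) x.ofLp).measurable
  have := Measure.isProbabilityMeasure_map (μ := stdGaussianEntries n p) hf.aemeasurable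
  rw [← charFun_eq_pi_iff]
  intro t
  have key := charFun_pi (μ := fun _ : Fin n × Fin p => gaussianReal 0 1)
    (t := WithLp.toLp 2 fun ij : Fin n × Fin p => t ij.1 * x ij.2)
  have h1 : charFun (((stdGaussianEntries n p).map (fun e => toMat e *ᵥ x.ofLp)).map
      (WithLp.toLp 2)) t = charFun ((stdGaussianEntries n p).map (WithLp.toLp 2))
        (WithLp.toLp 2 fun ij : Fin n × Fin p => t ij.1 * x ij.2) := by
    rw [charFun_apply, charFun_apply, integral_map (by fun_prop) (by fun_prop),
      integral_map hf.aemeasurable (by fun_prop), integral_map (by fun_prop) (by fun_prop)]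
    congr 1 with e
    congr 3
    simp only [PiLp.inner_apply, toMat, mulVec, dotProduct, Matrix.of_apply, Fintype.sum_prod_type]
    refine Finset.sum_congr rfl fun i _ => ?_
    simp [Finset.mul_sum, mul_comm, mul_assoc]
  rw [h1]
  refine key.trans ?_
  simp only [charFun_gaussianReal, Fintype.prod_prod_type]
  refine Finset.prod_congr rfl fun i _ => ?_
  rw [← Complex.exp_sum]
  congr 1
  have h2 : ((‖x‖₊ ^ 2 : NNReal) : ℝ) = ∑ j, x j ^ 2 := by
    simp [EuclideanSpace.norm_sq_eq]
  have h3 : (((‖x‖₊ ^ 2 : NNReal) : ℝ) : ℂ) = ∑ j, (x j : ℂ) ^ 2 := by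
    rw [h2]; push_cast; rfl
  rw [h3]
  simp [Finset.mul_sum, Finset.sum_div, mul_pow, mul_comm]

theorem lintegral_exp_mul_norm_sq {n p : ℕ} (x : EuclideanSpace ℝ (Fin p)) {θ : ℝ}
    (h : 2 * θ * ‖x‖ ^ 2 < 1) :
    ∫⁻ e, ENNReal.ofReal (Real.exp (θ * ‖WithLp.toLp 2 (toMat e *ᵥ x.ofLp)‖ ^ 2))
      ∂(stdGaussianEntries n p) = ENNReal.ofReal ((√(1 - 2 * θ * ‖x‖ ^ 2))⁻¹ ^ n) := by
  have hf := (continuous_toMat_mulVec (n := n) x.ofLp).measurable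
  have h1 : ∀ e : Fin n × Fin p → ℝ,
      ENNReal.ofReal (Real.exp (θ * ‖WithLp.toLp 2 (toMat e *ᵥ x.ofLp)‖ ^ 2)) =
      (fun y : Fin n → ℝ => ∏ i, ENNReal.ofReal (Real.exp (θ * y i ^ 2))) (toMat e *ᵥ x.ofLp) := by
    intro e
    rw [EuclideanSpace.norm_sq_eq, Finset.mul_sum, Real.exp_sum,
      ENNReal.ofReal_prod_of_nonneg fun _ _ => by positivity]
    simp
  simp_rw [h1]
  rw [← lintegral_map (μ := stdGaussianEntries n p)
    (f := fun y : Fin n → ℝ => ∏ i, ENNReal.ofReal (Real.exp (θ * y i ^ 2))) (by fun_prop) hf,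
    map_mulVec_stdGaussianEntries,
    lintegral_prod_eq_prod_lintegral_of_indepFun Finset.univ
      (fun i (y : Fin n → ℝ) => ENNReal.ofReal (Real.exp (θ * y i ^ 2)))]
  · rw [ENNReal.ofReal_pow (by positivity)]
    have h2 : ∀ i : Fin n, ∫⁻ y : Fin n → ℝ, ENNReal.ofReal (Real.exp (θ * y i ^ 2))
        ∂(Measure.pi fun _ => gaussianReal 0 (‖x‖₊ ^ 2)) =
        ENNReal.ofReal ((√(1 - 2 * θ * ‖x‖ ^ 2))⁻¹) := by
      intro i
      have := (measurePreserving_eval (fun _ : Fin n => gaussianReal 0 (‖x‖₊ ^ 2)) i).lintegral_comp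
        (f := fun y => ENNReal.ofReal (Real.exp (θ * y ^ 2))) (by fun_prop)
      simp only [Function.eval] at this
      rw [this, lintegral_exp_mul_sq_gaussianReal _ (by simpa using h)]
      simp
    simp [h2]
  · exact iIndepFun_pi (X := fun _ y => ENNReal.ofReal (Real.exp (θ * y ^ 2)))
      (fun _ => by fun_prop)
  · intro i; fun_prop

section
open scoped Matrix.Norms.L2Operator

/-- The operator-norm distance of `Mᵀ M / n` to the identity. -/
noncomputable def gramDev {n p : ℕ} (M : Matrix (Fin n) (Fin p) ℝ) : ℝ := ‖sampleCov M - 1‖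

theorem gramDev_nonneg {n p : ℕ} (M : Matrix (Fin n) (Fin p) ℝ) : 0 ≤ gramDev M := norm_nonneg _

theorem continuous_toMat {n p : ℕ} : Continuous (toMat : (Fin n × Fin p → ℝ) → _) :=
  continuous_matrix fun i j => by simp only [toMat, Matrix.of_apply]; fun_prop

theorem continuous_sampleCov {n p : ℕ} :
    Continuous (sampleCov : Matrix (Fin n) (Fin p) ℝ → _) := by
  unfold sampleCov; fun_prop

theorem continuous_gramDev {n p : ℕ} :
    Continuous (gramDev : Matrix (Fin n) (Fin p) ℝ → ℝ) := by
  unfold gramDev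
  exact (continuous_sampleCov.sub continuous_const).norm

theorem isSymm_sampleCov {n p : ℕ} (M : Matrix (Fin n) (Fin p) ℝ) : (sampleCov M).IsSymm := by
  simp [sampleCov, Matrix.IsSymm]

theorem inner_toLp_mulVec_sampleCov {n p : ℕ} (M : Matrix (Fin n) (Fin p) ℝ)
    (x : EuclideanSpace ℝ (Fin p)) :
    inner ℝ x (WithLp.toLp 2 (sampleCov M *ᵥ x.ofLp)) =
      ‖WithLp.toLp 2 (M *ᵥ x.ofLp)‖ ^ 2 / n := by
  rw [← real_inner_self_eq_norm_sq, EuclideanSpace.inner_eq_star_dotProduct,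
    EuclideanSpace.inner_eq_star_dotProduct]
  simp [sampleCov, Matrix.smul_mulVec, ← Matrix.mulVec_mulVec, Matrix.mulVec_transpose,
    ← Matrix.dotProduct_mulVec, div_eq_inv_mul]

theorem inner_toLp_mulVec_sampleCov_sub_one {n p : ℕ} (M : Matrix (Fin n) (Fin p) ℝ)
    (x : EuclideanSpace ℝ (Fin p)) :
    inner ℝ x (WithLp.toLp 2 ((sampleCov M - 1) *ᵥ x.ofLp)) =
      ‖WithLp.toLp 2 (M *ᵥ x.ofLp)‖ ^ 2 / n - ‖x‖ ^ 2 := by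
  rw [Matrix.sub_mulVec, WithLp.toLp_sub, inner_sub_right, inner_toLp_mulVec_sampleCov]
  simp

/-- A real symmetric operator attains its norm on the quadratic form of a unit vector. -/
theorem exists_norm_le_abs_inner {E : Type*} [NormedAddCommGroup E] [InnerProductSpace ℝ E]
    [FiniteDimensional ℝ E] [Nontrivial E] (T : E →L[ℝ] E)
    (hT : (T : E →ₗ[ℝ] E).IsSymmetric) :
    ∃ v, ‖v‖ = 1 ∧ ‖T‖ ≤ |inner ℝ v (T v)| := by
  obtain ⟨v, hv, hmax⟩ := (isCompact_sphere (0 : E) 1).exists_isMaxOn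
    (NormedSpace.sphere_nonempty.2 zero_le_one)
    (f := fun v => |inner ℝ v (T v)|) (by fun_prop)
  have hv1 : ‖v‖ = 1 := by simpa using hv
  refine ⟨v, hv1, ?_⟩
  set c := |inner ℝ v (T v)| with hc
  have hq : ∀ x, |inner ℝ x (T x)| ≤ c * ‖x‖ ^ 2 := by
    intro x
    by_cases hx : x = 0
    · simp [hx]
    have hx' : 0 < ‖x‖ := norm_pos_iff.2 hx
    have h1 : |inner ℝ (‖x‖⁻¹ • x) (T (‖x‖⁻¹ • x))| ≤ c :=
      hmax (by simp [norm_smul, hx'.ne'])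
    rw [map_smul, inner_smul_left, inner_smul_right, abs_mul, abs_mul] at h1
    simp only [RCLike.conj_to_real, abs_inv, abs_norm] at h1
    calc |inner ℝ x (T x)| = (‖x‖⁻¹ * (‖x‖⁻¹ * |inner ℝ x (T x)|)) * ‖x‖ ^ 2 := by
          field_simp
      _ ≤ c * ‖x‖ ^ 2 := by gcongr
  refine T.opNorm_le_of_unit_norm (abs_nonneg _) fun x hx => ?_
  by_cases hTx : T x = 0
  · simp [hTx, hc]
  have hT' : 0 < ‖T x‖ := norm_pos_iff.2 hTx
  set y := ‖T x‖⁻¹ • T x with hy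
  have hy1 : ‖y‖ = 1 := by simp [hy, norm_smul, hT'.ne']
  have h1 : inner ℝ y (T x) = ‖T x‖ := by
    rw [hy, inner_smul_left, real_inner_self_eq_norm_sq]
    simp only [RCLike.conj_to_real]
    field_simp
  have h2 : inner ℝ x (T y) = inner ℝ y (T x) := by
    rw [real_inner_comm]; exact hT y x
  have h3 : 4 * inner ℝ y (T x) =
      inner ℝ (x + y) (T (x + y)) - inner ℝ (x - y) (T (x - y)) := by
    simp only [map_add, map_sub, inner_add_left, inner_add_right, inner_sub_left, inner_sub_right,
      h2]
    ring
  have h4 := (abs_le.1 (hq (x + y))).2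
  have h5 := (abs_le.1 (hq (x - y))).1
  have h6 := parallelogram_law_with_norm ℝ x y
  rw [hx, hy1] at h6
  have h7 : c * ‖x + y‖ ^ 2 + c * ‖x - y‖ ^ 2 = 4 * c := by
    rw [← mul_add]
    linear_combination c * h6
  linarith

theorem exists_gramDev_le {n p : ℕ} (hp : 0 < p) (M : Matrix (Fin n) (Fin p) ℝ) :
    ∃ v : EuclideanSpace ℝ (Fin p), ‖v‖ = 1 ∧
      gramDev M ≤ |inner ℝ v (WithLp.toLp 2 ((sampleCov M - 1) *ᵥ v.ofLp))| := by
  have : NeZero p := ⟨hp.ne'⟩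
  have hs : (sampleCov M - 1).IsHermitian := by
    have := isSymm_sampleCov M
    rw [Matrix.IsHermitian, Matrix.conjTranspose_eq_transpose_of_trivial, Matrix.transpose_sub,
      this.eq, Matrix.transpose_one]
  exact exists_norm_le_abs_inner (Matrix.toEuclideanCLM (n := Fin p) (𝕜 := ℝ) (sampleCov M - 1))
    (Matrix.isSymmetric_toEuclideanLin_iff.2 hs)

theorem half_gramDev_le_of_mem_ball {n p : ℕ} (M : Matrix (Fin n) (Fin p) ℝ)
    {v x : EuclideanSpace ℝ (Fin p)} (hv : ‖v‖ = 1)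
    (h : gramDev M ≤ |inner ℝ v (WithLp.toLp 2 ((sampleCov M - 1) *ᵥ v.ofLp))|)
    (hx : x ∈ Metric.ball v (1 / 8)) :
    gramDev M / 2 ≤ |‖WithLp.toLp 2 (M *ᵥ x.ofLp)‖ ^ 2 / n - ‖x‖ ^ 2| := by
  rw [← inner_toLp_mulVec_sampleCov_sub_one]
  set A := sampleCov M - 1
  have hL : ∀ y : EuclideanSpace ℝ (Fin p), ‖WithLp.toLp 2 (A *ᵥ y.ofLp)‖ ≤ gramDev M * ‖y‖ :=
    fun y => Matrix.l2_opNorm_mulVec A y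
  have hL0 := gramDev_nonneg M
  have hd : ‖x - v‖ ≤ 1 / 8 := by
    rw [← dist_eq_norm]; exact (Metric.mem_ball.1 hx).le
  have hx1 : ‖x‖ ≤ 9 / 8 := by
    have := norm_add_le (x - v) v
    rw [sub_add_cancel, hv] at this
    linarith
  have e1 : inner ℝ x (WithLp.toLp 2 (A *ᵥ x.ofLp)) - inner ℝ v (WithLp.toLp 2 (A *ᵥ v.ofLp)) =
      inner ℝ (x - v) (WithLp.toLp 2 (A *ᵥ x.ofLp)) +
        inner ℝ v (WithLp.toLp 2 (A *ᵥ (x - v).ofLp)) := by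
    rw [WithLp.ofLp_sub, Matrix.mulVec_sub, WithLp.toLp_sub, inner_sub_left, inner_sub_right]
    ring
  have e2 : |inner ℝ (x - v) (WithLp.toLp 2 (A *ᵥ x.ofLp))| ≤ 1 / 8 * (gramDev M * (9 / 8)) := by
    refine (abs_real_inner_le_norm _ _).trans ?_
    gcongr
    exact (hL x).trans (by gcongr)
  have e3 : |inner ℝ v (WithLp.toLp 2 (A *ᵥ (x - v).ofLp))| ≤ 1 * (gramDev M * (1 / 8)) := by
    refine (abs_real_inner_le_norm _ _).trans ?_
    rw [hv]
    gcongr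
    exact (hL _).trans (by gcongr)
  have e4 := abs_sub_abs_le_abs_sub (inner ℝ v (WithLp.toLp 2 (A *ᵥ v.ofLp)))
    (inner ℝ x (WithLp.toLp 2 (A *ᵥ x.ofLp)))
  rw [abs_sub_comm, e1] at e4
  have e5 := abs_add_le (inner ℝ (x - v) (WithLp.toLp 2 (A *ᵥ x.ofLp)))
    (inner ℝ v (WithLp.toLp 2 (A *ᵥ (x - v).ofLp)))
  linarith

theorem inv_one_sub_le_exp {y : ℝ} (hy : y ≤ 1 / 2) : (1 - y)⁻¹ ≤ Real.exp (y + y ^ 2) := by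
  rw [inv_le_iff_one_le_mul₀ (by linarith)]
  rcases le_or_gt 0 y with h | h
  · have h1 := Real.quadratic_le_exp_of_nonneg (x := y + y ^ 2) (by positivity)
    have h2 : 1 + y + 3 / 2 * y ^ 2 + y ^ 3 ≤ Real.exp (y + y ^ 2) := by
      nlinarith [pow_nonneg h 4]
    have h3 : 0 ≤ 1 / 2 - y / 2 - y ^ 2 := by nlinarith
    have h4 : 1 ≤ (1 + y + 3 / 2 * y ^ 2 + y ^ 3) * (1 - y) := by
      nlinarith [mul_nonneg (sq_nonneg y) h3]
    exact h4.trans (mul_le_mul_of_nonneg_right h2 (by linarith))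
  · have h1 := Real.add_one_le_exp (y + y ^ 2)
    have h4 : 1 ≤ (y + y ^ 2 + 1) * (1 - y) := by
      nlinarith [mul_nonneg (sq_nonneg y) (neg_nonneg.2 h.le)]
    exact h4.trans (mul_le_mul_of_nonneg_right h1 (by linarith))

theorem inv_sqrt_one_sub_le_exp {y : ℝ} (hy : y ≤ 1 / 2) :
    (√(1 - y))⁻¹ ≤ Real.exp ((y + y ^ 2) / 2) := by
  rw [← Real.sqrt_inv, Real.exp_half]
  exact Real.sqrt_le_sqrt (inv_one_sub_le_exp hy)

theorem continuous_norm_toMat_mulVec {n p : ℕ} :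
    Continuous fun z : (Fin n × Fin p → ℝ) × EuclideanSpace ℝ (Fin p) =>
      ‖WithLp.toLp 2 (toMat z.1 *ᵥ z.2.ofLp)‖ := by
  have : Continuous fun z : (Fin n × Fin p → ℝ) × EuclideanSpace ℝ (Fin p) =>
      toMat z.1 *ᵥ z.2.ofLp := by
    refine continuous_pi fun i => ?_
    simp only [toMat, mulVec, dotProduct, Matrix.of_apply]
    fun_prop
  fun_prop

theorem lintegral_exp_quadForm_le {n p : ℕ} (hn : 0 < n) (x : EuclideanSpace ℝ (Fin p))
    (hx : ‖x‖ ≤ 9 / 8) {τ : ℝ} (hτ : |τ| ≤ n / 6) :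
    ∫⁻ e, ENNReal.ofReal (Real.exp
        (τ * (‖WithLp.toLp 2 (toMat e *ᵥ x.ofLp)‖ ^ 2 / n - ‖x‖ ^ 2))) ∂(stdGaussianEntries n p) ≤
      ENNReal.ofReal (Real.exp (4 * τ ^ 2 / n)) := by
  have hn' : (0 : ℝ) < n := by exact_mod_cast hn
  have hX : ‖x‖ ^ 2 ≤ 81 / 64 := by nlinarith [norm_nonneg x]
  set X := ‖x‖ ^ 2 with hXdef
  have hX0 : 0 ≤ X := by positivity
  have hy : 2 * (τ / n) * X ≤ 1 / 2 := by
    have h1 : τ / n ≤ 1 / 6 := by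
      rw [div_le_iff₀ hn']; linarith [le_abs_self τ]
    nlinarith
  have h1 : ∀ e : Fin n × Fin p → ℝ, ENNReal.ofReal (Real.exp
        (τ * (‖WithLp.toLp 2 (toMat e *ᵥ x.ofLp)‖ ^ 2 / n - X))) =
      ENNReal.ofReal (Real.exp (-(τ * X))) * ENNReal.ofReal (Real.exp
        (τ / n * ‖WithLp.toLp 2 (toMat e *ᵥ x.ofLp)‖ ^ 2)) := by
    intro e
    rw [← ENNReal.ofReal_mul (by positivity), ← Real.exp_add]
    congr 2
    ring
  simp_rw [h1]
  rw [lintegral_const_mul' _ _ ENNReal.ofReal_ne_top,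
    lintegral_exp_mul_norm_sq x (by rw [← hXdef]; linarith), ← ENNReal.ofReal_mul (by positivity)]
  apply ENNReal.ofReal_le_ofReal
  rw [← hXdef]
  calc Real.exp (-(τ * X)) * (√(1 - 2 * (τ / n) * X))⁻¹ ^ n
      ≤ Real.exp (-(τ * X)) *
          Real.exp ((2 * (τ / n) * X + (2 * (τ / n) * X) ^ 2) / 2) ^ n := by
        gcongr
        exact inv_sqrt_one_sub_le_exp hy
    _ = Real.exp (2 * X ^ 2 * (τ ^ 2 / n)) := by
        rw [← Real.exp_nat_mul, ← Real.exp_add]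
        congr 1
        field_simp
        ring
    _ ≤ Real.exp (4 * τ ^ 2 / n) := by
        rw [mul_div_assoc]
        gcongr
        nlinarith

theorem lintegral_exp_half_gramDev_le {n p : ℕ} (hn : 0 < n) (hp : 0 < p) {θ : ℝ} (h0 : 0 ≤ θ)
    (hθ : θ ≤ n / 6) :
    ∫⁻ e, ENNReal.ofReal (Real.exp (θ * (gramDev (toMat e) / 2))) ∂(stdGaussianEntries n p) ≤
      ENNReal.ofReal (2 * 9 ^ p * Real.exp (4 * θ ^ 2 / n)) := by
  set E := EuclideanSpace ℝ (Fin p)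
  have : NeZero p := ⟨hp.ne'⟩
  let q : (Fin n × Fin p → ℝ) → E → ℝ := fun e x =>
    ‖WithLp.toLp 2 (toMat e *ᵥ x.ofLp)‖ ^ 2 / n - ‖x‖ ^ 2
  have hq : Continuous (Function.uncurry q) :=
    ((continuous_norm_toMat_mulVec.pow 2).div_const _).sub (continuous_snd.norm.pow 2)
  let F : (Fin n × Fin p → ℝ) → E → ENNReal := fun e x =>
    ENNReal.ofReal (Real.exp (θ * q e x)) + ENNReal.ofReal (Real.exp (-θ * q e x))
  have hF : Measurable (Function.uncurry F) := by
    have h1 : Continuous (Function.uncurry F) := by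
      have a1 : Continuous fun z : (Fin n × Fin p → ℝ) × E =>
        ENNReal.ofReal (Real.exp (θ * Function.uncurry q z)) :=
          ENNReal.continuous_ofReal.comp (Real.continuous_exp.comp (continuous_const.mul hq))
      have a2 : Continuous fun z : (Fin n × Fin p → ℝ) × E =>
        ENNReal.ofReal (Real.exp (-θ * Function.uncurry q z)) :=
          ENNReal.continuous_ofReal.comp (Real.continuous_exp.comp (continuous_const.mul hq))
      exact a1.add a2
    exact h1.measurable
  have hpt : ∀ e, ENNReal.ofReal (Real.exp (θ * (gramDev (toMat e) / 2))) *
      volume (Metric.ball (0 : E) (1 / 8)) ≤ ∫⁻ x in Metric.ball 0 (9 / 8), F e x := by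
    intro e
    obtain ⟨v, hv, hL⟩ := exists_gramDev_le hp (toMat e)
    rw [← Measure.addHaar_ball_center volume v, ← setLIntegral_const]
    have hsub : Metric.ball v (1 / 8) ⊆ Metric.ball (0 : E) (9 / 8) := by
      apply Metric.ball_subset_ball'
      rw [dist_zero_right, hv]; norm_num
    refine le_trans ?_ (lintegral_mono_set hsub)
    refine setLIntegral_mono' measurableSet_ball fun x hx => ?_
    have h1 := half_gramDev_le_of_mem_ball (toMat e) hv hL hx
    rcases le_abs.1 h1 with h | h
    · refine le_trans (ENNReal.ofReal_le_ofReal ?_) le_self_add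
      exact Real.exp_le_exp.2 (mul_le_mul_of_nonneg_left h h0)
    · refine le_trans (ENNReal.ofReal_le_ofReal ?_) le_add_self
      refine Real.exp_le_exp.2 ?_
      rw [neg_mul, ← mul_neg]
      exact mul_le_mul_of_nonneg_left h h0
  have hB0 : volume (Metric.ball (0 : E) 1) ≠ 0 := (Metric.measure_ball_pos _ _ one_pos).ne'
  have hBt : volume (Metric.ball (0 : E) 1) ≠ ⊤ := measure_ball_lt_top.ne
  have hmain : (∫⁻ e, ENNReal.ofReal (Real.exp (θ * (gramDev (toMat e) / 2)))
      ∂(stdGaussianEntries n p)) * volume (Metric.ball (0 : E) (1 / 8)) ≤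
      ENNReal.ofReal (2 * Real.exp (4 * θ ^ 2 / n)) * volume (Metric.ball (0 : E) (9 / 8)) := by
    rw [← lintegral_mul_const' _ _ measure_ball_lt_top.ne]
    refine (lintegral_mono hpt).trans ?_
    rw [lintegral_lintegral_swap hF.aemeasurable, ← setLIntegral_const]
    refine setLIntegral_mono' measurableSet_ball fun x hx => ?_
    have hx' : ‖x‖ ≤ 9 / 8 := (mem_ball_zero_iff.1 hx).le
    have hm : Measurable fun e : Fin n × Fin p → ℝ => ENNReal.ofReal (Real.exp (θ * q e x)) := by
      have hm1 : Measurable fun e => q e x := hq.measurable.of_uncurry_right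
      exact (Real.measurable_exp.comp (hm1.const_mul θ)).ennreal_ofReal
    simp only [F]
    rw [lintegral_add_left hm, two_mul, ENNReal.ofReal_add (by positivity) (by positivity)]
    refine add_le_add (lintegral_exp_quadForm_le hn x hx' (by rwa [abs_of_nonneg h0])) ?_
    have := lintegral_exp_quadForm_le (τ := -θ) hn x hx' (by rwa [abs_neg, abs_of_nonneg h0])
    rwa [neg_sq] at this
  rw [Measure.addHaar_ball_of_pos volume _ (by norm_num : (0 : ℝ) < 1 / 8),
    Measure.addHaar_ball_of_pos volume _ (by norm_num : (0 : ℝ) < 9 / 8), finrank_euclideanSpace,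
    Fintype.card_fin, ← mul_assoc, ← mul_assoc, ENNReal.mul_le_mul_iff_left hB0 hBt,
    ← ENNReal.ofReal_mul (by positivity)] at hmain
  have h8 : ENNReal.ofReal ((1 / 8 : ℝ) ^ p) ≠ 0 := by
    rw [ne_eq, ENNReal.ofReal_eq_zero, not_le]; positivity
  rw [← ENNReal.mul_le_mul_iff_left h8 ENNReal.ofReal_ne_top, ← ENNReal.ofReal_mul (by positivity)]
  refine hmain.trans (ENNReal.ofReal_le_ofReal (le_of_eq ?_))
  rw [show (9 / 8 : ℝ) = 9 * (1 / 8) by norm_num, mul_pow]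
  ring

/-- The matrices whose smallest singular value is at most `τ ^ 2 * √n`. -/
def smallSingularSet (n p : ℕ) (τ : ℝ) : Set (Fin n × Fin p → ℝ) :=
  {e | ∃ v : EuclideanSpace ℝ (Fin p), ‖v‖ = 1 ∧ ‖WithLp.toLp 2 (toMat e *ᵥ v.ofLp)‖ ≤ τ ^ 2 * √n}

theorem norm_mulVec_le_gramDev {n p : ℕ} (hn : 0 < n) (M : Matrix (Fin n) (Fin p) ℝ)
    (y : EuclideanSpace ℝ (Fin p)) :
    ‖WithLp.toLp 2 (M *ᵥ y.ofLp)‖ ≤ √n * (1 + gramDev M) * ‖y‖ := by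
  have hn' : (0 : ℝ) < n := by exact_mod_cast hn
  have hL := gramDev_nonneg M
  have h1 := inner_toLp_mulVec_sampleCov_sub_one M y
  have h2 := (le_abs_self _).trans
    (abs_real_inner_le_norm y (WithLp.toLp 2 ((sampleCov M - 1) *ᵥ y.ofLp)))
  have h3 : ‖WithLp.toLp 2 ((sampleCov M - 1) *ᵥ y.ofLp)‖ ≤ gramDev M * ‖y‖ :=
    Matrix.l2_opNorm_mulVec _ y
  have h4 : ‖WithLp.toLp 2 (M *ᵥ y.ofLp)‖ ^ 2 / n ≤ (1 + gramDev M) * ‖y‖ ^ 2 := by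
    have := mul_le_mul_of_nonneg_left h3 (norm_nonneg y)
    nlinarith
  rw [div_le_iff₀ hn'] at h4
  refine abs_le_of_sq_le_sq' ?_ (by positivity) |>.2
  rw [mul_pow, mul_pow, Real.sq_sqrt hn'.le]
  refine h4.trans ?_
  have : (1 + gramDev M) ≤ (1 + gramDev M) ^ 2 := by nlinarith
  calc (1 + gramDev M) * ‖y‖ ^ 2 * n = n * (1 + gramDev M) * ‖y‖ ^ 2 := by ring
    _ ≤ _ := by gcongr

theorem lintegral_gramDev_pow_le {n p : ℕ} (hp : 0 < p) (hpn : p ≤ n) :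
    ∫⁻ e, ENNReal.ofReal ((1 + gramDev (toMat e)) ^ p) ∂(stdGaussianEntries n p) ≤
      ENNReal.ofReal (2 * 324 ^ n) := by
  have hn : 0 < n := hp.trans_le hpn
  have hn' : (0 : ℝ) < n := by exact_mod_cast hn
  have h1 : ∀ e : Fin n × Fin p → ℝ, ENNReal.ofReal ((1 + gramDev (toMat e)) ^ p) ≤
      ENNReal.ofReal (12 ^ n) *
        ENNReal.ofReal (Real.exp ((n : ℝ) / 6 * (gramDev (toMat e) / 2))) := by
    intro e
    rw [← ENNReal.ofReal_mul (by positivity)]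
    apply ENNReal.ofReal_le_ofReal
    have hL := gramDev_nonneg (toMat e)
    calc (1 + gramDev (toMat e)) ^ p ≤ (1 + gramDev (toMat e)) ^ n :=
          pow_le_pow_right₀ (by linarith) hpn
      _ ≤ (12 * Real.exp (gramDev (toMat e) / 12)) ^ n := by
          gcongr
          linarith [Real.add_one_le_exp (gramDev (toMat e) / 12)]
      _ = _ := by
          rw [mul_pow, ← Real.exp_nat_mul]
          congr 2
          ring
  refine (lintegral_mono h1).trans ?_
  rw [lintegral_const_mul' _ _ ENNReal.ofReal_ne_top]
  refine (mul_le_mul_right (lintegral_exp_half_gramDev_le hn hp (by positivity) le_rfl) _).trans ?_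
  rw [← ENNReal.ofReal_mul (by positivity)]
  apply ENNReal.ofReal_le_ofReal
  have h2 : Real.exp (4 * ((n : ℝ) / 6) ^ 2 / n) ≤ 3 ^ n := by
    calc Real.exp (4 * ((n : ℝ) / 6) ^ 2 / n) ≤ Real.exp (n * 1) := by
          apply Real.exp_le_exp.2
          have : 4 * ((n : ℝ) / 6) ^ 2 / n = n / 9 := by field_simp; norm_num
          rw [this]; linarith
      _ = Real.exp 1 ^ n := Real.exp_nat_mul _ _
      _ ≤ 3 ^ n := by gcongr; exact Real.exp_one_lt_three.le
  have h3 : (9 : ℝ) ^ p ≤ 9 ^ n := pow_le_pow_right₀ (by norm_num) hpn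
  calc (12 : ℝ) ^ n * (2 * 9 ^ p * Real.exp (4 * ((n : ℝ) / 6) ^ 2 / n))
      ≤ 12 ^ n * (2 * 9 ^ n * 3 ^ n) := by gcongr
    _ = 2 * 324 ^ n := by
      rw [show (324 : ℝ) = 12 * 9 * 3 by norm_num, mul_pow, mul_pow]; ring

theorem inv_sqrt_one_add_le {t X : ℝ} (ht : 0 < t) (hX : 1 / 2 ≤ X) :
    (√(1 - 2 * (-(2 * t ^ 2)⁻¹) * X ^ 2))⁻¹ ≤ 2 * t := by
  rw [inv_le_comm₀ (Real.sqrt_pos.2 (by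
    have : 0 < (2 * t ^ 2)⁻¹ * X ^ 2 := by positivity
    nlinarith)) (by positivity)]
  apply Real.le_sqrt_of_sq_le
  have h1 : 1 / 4 ≤ X ^ 2 := by nlinarith
  have h2 : (2 * t)⁻¹ ^ 2 = (t ^ 2)⁻¹ * (1 / 4) := by field_simp; norm_num
  have h3 : 2 * (-(2 * t ^ 2)⁻¹) * X ^ 2 = -((t ^ 2)⁻¹ * X ^ 2) := by field_simp
  rw [h2, h3]
  have : (t ^ 2)⁻¹ * (1 / 4) ≤ (t ^ 2)⁻¹ * X ^ 2 := by gcongr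
  linarith

theorem measurable_exp_norm_sq {n p : ℕ} (c : ℝ) :
    Measurable (Function.uncurry fun (e : Fin n × Fin p → ℝ) (x : EuclideanSpace ℝ (Fin p)) =>
      ENNReal.ofReal (Real.exp (c * ‖WithLp.toLp 2 (toMat e *ᵥ x.ofLp)‖ ^ 2))) := by
  have h : Continuous fun z : (Fin n × Fin p → ℝ) × EuclideanSpace ℝ (Fin p) =>
      ENNReal.ofReal (Real.exp (c * ‖WithLp.toLp 2 (toMat z.1 *ᵥ z.2.ofLp)‖ ^ 2)) :=
    ENNReal.continuous_ofReal.comp (Real.continuous_exp.comp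
      (continuous_const.mul (continuous_norm_toMat_mulVec.pow 2)))
  exact h.measurable

theorem lintegral_lintegral_annulus_le {n p : ℕ} (hp : 0 < p) {t : ℝ} (ht : 0 < t) :
    ∫⁻ e, (∫⁻ x in Metric.ball (0 : EuclideanSpace ℝ (Fin p)) (3 / 2) ∩ {x | 1 / 2 ≤ ‖x‖},
        ENNReal.ofReal (Real.exp (-(2 * t ^ 2)⁻¹ * ‖WithLp.toLp 2 (toMat e *ᵥ x.ofLp)‖ ^ 2)))
      ∂(stdGaussianEntries n p) ≤
    ENNReal.ofReal ((2 * t) ^ n * (3 / 2) ^ p) *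
      volume (Metric.ball (0 : EuclideanSpace ℝ (Fin p)) 1) := by
  have : NeZero p := ⟨hp.ne'⟩
  have hm : MeasurableSet (Metric.ball (0 : EuclideanSpace ℝ (Fin p)) (3 / 2) ∩
      {x | 1 / 2 ≤ ‖x‖}) :=
    measurableSet_ball.inter (measurableSet_le measurable_const measurable_norm)
  rw [lintegral_lintegral_swap (measurable_exp_norm_sq _).aemeasurable]
  have h1 : ∀ x ∈ Metric.ball (0 : EuclideanSpace ℝ (Fin p)) (3 / 2) ∩ {x | 1 / 2 ≤ ‖x‖},
      ∫⁻ e, ENNReal.ofReal (Real.exp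
        (-(2 * t ^ 2)⁻¹ * ‖WithLp.toLp 2 (toMat e *ᵥ x.ofLp)‖ ^ 2)) ∂(stdGaussianEntries n p) ≤
      ENNReal.ofReal ((2 * t) ^ n) := by
    intro x hx
    rw [lintegral_exp_mul_norm_sq x]
    · apply ENNReal.ofReal_le_ofReal
      gcongr
      exact inv_sqrt_one_add_le ht hx.2
    · have : 0 ≤ (2 * t ^ 2)⁻¹ * ‖x‖ ^ 2 := by positivity
      nlinarith
  refine (setLIntegral_mono' hm h1).trans ?_
  rw [setLIntegral_const, ENNReal.ofReal_mul (by positivity), mul_assoc]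
  refine mul_le_mul_right ((measure_mono Set.inter_subset_left).trans ?_) _
  rw [Measure.addHaar_ball_of_pos volume _ (by norm_num : (0 : ℝ) < 3 / 2), finrank_euclideanSpace,
    Fintype.card_fin]

theorem volume_le_lintegral_annulus {n p : ℕ} (hn : 0 < n) (hp : 0 < p) {τ : ℝ} (hτ : 0 < τ)
    (hτ1 : τ ^ 2 ≤ 1 / 2) {e : Fin n × Fin p → ℝ} (he : e ∈ smallSingularSet n p τ) :
    ENNReal.ofReal (Real.exp (-(2 * n)) * (τ ^ 2 / (1 + gramDev (toMat e))) ^ p) *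
      volume (Metric.ball (0 : EuclideanSpace ℝ (Fin p)) 1) ≤
    ∫⁻ x in Metric.ball (0 : EuclideanSpace ℝ (Fin p)) (3 / 2) ∩ {x | 1 / 2 ≤ ‖x‖},
        ENNReal.ofReal (Real.exp
          (-(2 * (τ ^ 2) ^ 2)⁻¹ * ‖WithLp.toLp 2 (toMat e *ᵥ x.ofLp)‖ ^ 2)) := by
  have : NeZero p := ⟨hp.ne'⟩
  obtain ⟨v, hv, hMv⟩ := he
  have hL := gramDev_nonneg (toMat e)
  set K := 1 + gramDev (toMat e) with hK
  have hK1 : 1 ≤ K := by linarith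
  set r := τ ^ 2 / K with hr
  have hr0 : 0 < r := by positivity
  have hr1 : r ≤ 1 / 2 := (div_le_self (by positivity) hK1).trans hτ1
  have hd : ∀ x ∈ Metric.ball v r, ‖x - v‖ < r := fun x hx => by
    rw [← dist_eq_norm]; exact Metric.mem_ball.1 hx
  have hsub : Metric.ball v r ⊆
      Metric.ball (0 : EuclideanSpace ℝ (Fin p)) (3 / 2) ∩ {x | 1 / 2 ≤ ‖x‖} := by
    intro x hx
    have h1 := hd x hx
    have h2 := norm_sub_norm_le x v
    have h3 := norm_sub_norm_le v x
    rw [norm_sub_rev] at h3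
    refine ⟨mem_ball_zero_iff.2 (by linarith), ?_⟩
    simp only [Set.mem_ofPred_eq]
    linarith
  refine le_trans ?_ (lintegral_mono_set hsub)
  rw [ENNReal.ofReal_mul (by positivity), mul_assoc]
  have hvol := Measure.addHaar_ball_of_pos volume v hr0
  rw [finrank_euclideanSpace, Fintype.card_fin] at hvol
  rw [← hvol, ← setLIntegral_const]
  refine setLIntegral_mono' measurableSet_ball fun x hx => ENNReal.ofReal_le_ofReal ?_
  apply Real.exp_le_exp.2
  have h1 : ‖WithLp.toLp 2 (toMat e *ᵥ x.ofLp)‖ ≤ 2 * τ ^ 2 * √n := by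
    have h2 : WithLp.toLp 2 (toMat e *ᵥ x.ofLp) = WithLp.toLp 2 (toMat e *ᵥ v.ofLp) +
        WithLp.toLp 2 (toMat e *ᵥ (x - v).ofLp) := by
      rw [WithLp.ofLp_sub, Matrix.mulVec_sub, WithLp.toLp_sub, add_sub_cancel]
    have h3 := norm_mulVec_le_gramDev hn (toMat e) (x - v)
    have h4 : √n * K * ‖x - v‖ ≤ √n * K * r := by
      gcongr
      exact (hd x hx).le
    have h5 : √n * K * r = τ ^ 2 * √n := by
      rw [hr]; field_simp
    rw [h2]
    refine (norm_add_le _ _).trans ?_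
    linarith
  have h6 : ‖WithLp.toLp 2 (toMat e *ᵥ x.ofLp)‖ ^ 2 ≤ 4 * (τ ^ 2) ^ 2 * n := by
    calc _ ≤ (2 * τ ^ 2 * √n) ^ 2 := by gcongr
      _ = _ := by rw [mul_pow, Real.sq_sqrt (by positivity)]; ring
  have h7 : (2 * (τ ^ 2) ^ 2)⁻¹ * ‖WithLp.toLp 2 (toMat e *ᵥ x.ofLp)‖ ^ 2 ≤
      (2 * (τ ^ 2) ^ 2)⁻¹ * (4 * (τ ^ 2) ^ 2 * n) := by gcongr
  have h8 : (2 * (τ ^ 2) ^ 2)⁻¹ * (4 * (τ ^ 2) ^ 2 * n) = 2 * n := by field_simp; norm_num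
  linarith

theorem measure_smallSingularSet_le {n p : ℕ} (hp : 0 < p) (hpn : p ≤ n) {τ : ℝ} (hτ : 0 < τ)
    (hτ1 : τ ^ 2 ≤ 1 / 2) :
    stdGaussianEntries n p (smallSingularSet n p τ) ≤
      ENNReal.ofReal (1000 ^ n * τ ^ (n - p)) := by
  have : NeZero p := ⟨hp.ne'⟩
  have hn : 0 < n := hp.trans_le hpn
  set B := volume (Metric.ball (0 : EuclideanSpace ℝ (Fin p)) 1) with hB
  have hB0 : B ≠ 0 := (Metric.measure_ball_pos _ _ one_pos).ne'
  have hBt : B ≠ ⊤ := measure_ball_lt_top.ne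
  let H : (Fin n × Fin p → ℝ) → ENNReal := fun e =>
    ∫⁻ x in Metric.ball (0 : EuclideanSpace ℝ (Fin p)) (3 / 2) ∩ {x | 1 / 2 ≤ ‖x‖},
        ENNReal.ofReal (Real.exp
          (-(2 * (τ ^ 2) ^ 2)⁻¹ * ‖WithLp.toLp 2 (toMat e *ᵥ x.ofLp)‖ ^ 2))
  have hH : Measurable H := (measurable_exp_norm_sq _).lintegral_prod_right'
  let J : (Fin n × Fin p → ℝ) → ENNReal := fun e => ENNReal.ofReal ((1 + gramDev (toMat e)) ^ p)
  have hJ : Measurable J := by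
    have h1 : Continuous fun e : Fin n × Fin p → ℝ => gramDev (toMat e) :=
      continuous_gramDev.comp continuous_toMat
    exact ((continuous_const.add h1).pow p).measurable.ennreal_ofReal
  set s := τ ^ (n - p) with hs
  have hs0 : 0 < s := by positivity
  set c := s⁻¹ * Real.exp (2 * n) * ((τ ^ 2) ^ p)⁻¹ with hc
  have hc0 : 0 < c := by positivity
  have hpt : ∀ e ∈ smallSingularSet n p τ,
      B ≤ ENNReal.ofReal c * H e + ENNReal.ofReal s * B * J e := by
    intro e he
    have h1 := volume_le_lintegral_annulus hn hp hτ hτ1 he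
    have hL := gramDev_nonneg (toMat e)
    set K := 1 + gramDev (toMat e) with hK
    have hKp : 0 < K ^ p := by positivity
    have h2 : c * (Real.exp (-(2 * n)) * (τ ^ 2 / K) ^ p) = s⁻¹ * (K ^ p)⁻¹ := by
      rw [hc, Real.exp_neg, div_pow]
      field_simp
    have h3 : 1 ≤ s⁻¹ * (K ^ p)⁻¹ + s * K ^ p := by
      rw [← mul_inv]
      set u := s * K ^ p
      have hu : 0 < u := by positivity
      rcases le_total u 1 with h | h
      · have := (one_le_inv₀ hu).2 h
        linarith
      · have : 0 < u⁻¹ := by positivity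
        linarith
    calc B = ENNReal.ofReal 1 * B := by simp
      _ ≤ ENNReal.ofReal (s⁻¹ * (K ^ p)⁻¹ + s * K ^ p) * B := by gcongr
      _ = ENNReal.ofReal c * (ENNReal.ofReal (Real.exp (-(2 * n)) * (τ ^ 2 / K) ^ p) * B) +
          ENNReal.ofReal s * B * ENNReal.ofReal (K ^ p) := by
        rw [ENNReal.ofReal_add (by positivity) (by positivity), add_mul, ← h2,
          ENNReal.ofReal_mul hc0.le, ENNReal.ofReal_mul hs0.le, mul_assoc]
        congr 1
        ring
      _ ≤ _ := by gcongr
  have hmark := mul_meas_ge_le_lintegral (μ := stdGaussianEntries n p)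
    ((hH.const_mul (ENNReal.ofReal c)).add (hJ.const_mul (ENNReal.ofReal s * B))) B
  have hmono : stdGaussianEntries n p (smallSingularSet n p τ) ≤ stdGaussianEntries n p
      {e | B ≤ ENNReal.ofReal c * H e + ENNReal.ofReal s * B * J e} := measure_mono hpt
  have hint : ∫⁻ e, (ENNReal.ofReal c * H e + ENNReal.ofReal s * B * J e)
      ∂(stdGaussianEntries n p) ≤ B * ENNReal.ofReal (1000 ^ n * s) := by
    rw [lintegral_add_left (hH.const_mul _), lintegral_const_mul _ hH, lintegral_const_mul _ hJ]
    have h1 : ∫⁻ e, H e ∂(stdGaussianEntries n p) ≤ _ :=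
      lintegral_lintegral_annulus_le hp (by positivity : 0 < τ ^ 2)
    have h2 : ∫⁻ e, J e ∂(stdGaussianEntries n p) ≤ _ := lintegral_gramDev_pow_le hp hpn
    have h3 : c * ((2 * τ ^ 2) ^ n * (3 / 2) ^ p) ≤ 27 ^ n * s := by
      have h4 : (τ ^ 2) ^ n = s * s * (τ ^ 2) ^ p := by
        rw [hs, ← pow_mul, ← pow_mul, ← pow_add, ← pow_add]
        congr 1
        omega
      have h5 : Real.exp (2 * n) ≤ 9 ^ n := by
        rw [mul_comm, Real.exp_nat_mul]
        gcongr
        have : Real.exp 2 = Real.exp 1 * Real.exp 1 := by rw [← Real.exp_add]; norm_num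
        have := Real.exp_one_lt_three
        nlinarith [Real.exp_pos 1]
      calc c * ((2 * τ ^ 2) ^ n * (3 / 2) ^ p) = Real.exp (2 * n) * 2 ^ n * (3 / 2) ^ p * s := by
            rw [mul_pow, h4, hc]; field_simp
        _ ≤ 9 ^ n * 2 ^ n * (3 / 2) ^ n * s := by
            gcongr
            norm_num
        _ = 27 ^ n * s := by
            rw [show (27 : ℝ) = 9 * 2 * (3 / 2) by norm_num, mul_pow, mul_pow]
    calc ENNReal.ofReal c * (∫⁻ e, H e ∂(stdGaussianEntries n p)) +
          ENNReal.ofReal s * B * (∫⁻ e, J e ∂(stdGaussianEntries n p))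
        ≤ ENNReal.ofReal c * (ENNReal.ofReal ((2 * τ ^ 2) ^ n * (3 / 2) ^ p) * B) +
          ENNReal.ofReal s * B * ENNReal.ofReal (2 * 324 ^ n) := by gcongr
      _ = B * ENNReal.ofReal (c * ((2 * τ ^ 2) ^ n * (3 / 2) ^ p) + s * (2 * 324 ^ n)) := by
        rw [ENNReal.ofReal_add (by positivity) (by positivity), ENNReal.ofReal_mul hc0.le,
          ENNReal.ofReal_mul (p := s) hs0.le]
        ring
      _ ≤ B * ENNReal.ofReal (1000 ^ n * s) := by
        gcongr
        have h6 : (27 : ℝ) ^ n ≤ 324 ^ n := by gcongr; norm_num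
        have h7 : 3 * (324 : ℝ) ^ n ≤ 1000 ^ n := by
          obtain ⟨m, rfl⟩ := Nat.exists_eq_succ_of_ne_zero hn.ne'
          have : (324 : ℝ) ^ m ≤ 1000 ^ m := by gcongr; norm_num
          rw [pow_succ, pow_succ]
          linarith [pow_nonneg (by norm_num : (0 : ℝ) ≤ 1000) m]
        nlinarith
  rw [← ENNReal.mul_le_mul_iff_right hB0 hBt]
  exact (mul_le_mul_right hmono _).trans (hmark.trans hint)

theorem sq_mul_norm_le_of_notMem {n p : ℕ} (hn : 0 < n) {τ : ℝ} (hτ : 0 < τ)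
    {e : Fin n × Fin p → ℝ} (he : e ∉ smallSingularSet n p τ) (v : EuclideanSpace ℝ (Fin p)) :
    τ ^ 4 * ‖v‖ ≤ ‖WithLp.toLp 2 (sampleCov (toMat e) *ᵥ v.ofLp)‖ := by
  by_cases hv : v = 0
  · simp [hv]
  have hv0 : 0 < ‖v‖ := norm_pos_iff.2 hv
  have hn' : (0 : ℝ) < n := by exact_mod_cast hn
  have h1 : τ ^ 2 * √n < ‖WithLp.toLp 2 (toMat e *ᵥ (‖v‖⁻¹ • v).ofLp)‖ := by
    by_contra h
    exact he ⟨‖v‖⁻¹ • v, by simp [norm_smul, hv0.ne'], not_lt.1 h⟩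
  rw [WithLp.ofLp_smul, Matrix.mulVec_smul, WithLp.toLp_smul, norm_smul, norm_inv, norm_norm,
    ← div_eq_inv_mul, lt_div_iff₀ hv0] at h1
  have h2 : (τ ^ 2 * √n * ‖v‖) ^ 2 ≤ ‖WithLp.toLp 2 (toMat e *ᵥ v.ofLp)‖ ^ 2 := by gcongr
  rw [mul_pow, mul_pow, Real.sq_sqrt hn'.le] at h2
  have h3 := real_inner_le_norm v (WithLp.toLp 2 (sampleCov (toMat e) *ᵥ v.ofLp))
  rw [inner_toLp_mulVec_sampleCov, div_le_iff₀ hn'] at h3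
  have h4 : τ ^ 4 * ‖v‖ * (‖v‖ * n) ≤
      ‖WithLp.toLp 2 (sampleCov (toMat e) *ᵥ v.ofLp)‖ * (‖v‖ * n) := by
    nlinarith
  exact le_of_mul_le_mul_right h4 (by positivity)

theorem isUnit_det_of_notMem {n p : ℕ} (hn : 0 < n) {τ : ℝ} (hτ : 0 < τ)
    {e : Fin n × Fin p → ℝ} (he : e ∉ smallSingularSet n p τ) :
    IsUnit (sampleCov (toMat e)).det := by
  rw [isUnit_iff_ne_zero]
  intro h
  obtain ⟨v, hv, hv0⟩ := Matrix.exists_mulVec_eq_zero_iff.2 h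
  have h1 := sq_mul_norm_le_of_notMem hn hτ he (WithLp.toLp 2 v)
  simp only [hv0, WithLp.toLp_zero, norm_zero] at h1
  have h2 : 0 < ‖WithLp.toLp 2 v‖ := norm_pos_iff.2 (by simpa using hv)
  have : 0 < τ ^ 4 * ‖WithLp.toLp 2 v‖ := by positivity
  linarith

theorem norm_inv_le_of_notMem {n p : ℕ} (hn : 0 < n) {τ : ℝ} (hτ : 0 < τ)
    {e : Fin n × Fin p → ℝ} (he : e ∉ smallSingularSet n p τ) :
    ‖(sampleCov (toMat e))⁻¹‖ ≤ (τ ^ 4)⁻¹ := by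
  have hu := isUnit_det_of_notMem hn hτ he
  rw [Matrix.cstar_norm_def]
  refine ContinuousLinearMap.opNorm_le_bound _ (by positivity) fun y => ?_
  have h1 := sq_mul_norm_le_of_notMem hn hτ he
    (WithLp.toLp 2 ((sampleCov (toMat e))⁻¹ *ᵥ y.ofLp))
  simp only [Matrix.mulVec_mulVec, Matrix.mul_nonsing_inv _ hu, Matrix.one_mulVec] at h1
  rw [le_inv_mul_iff₀ (by positivity)]
  exact h1

theorem norm_inv_sub_one_le {n p : ℕ} {M : Matrix (Fin n) (Fin p) ℝ}
    (h : IsUnit (sampleCov M).det) :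
    ‖(sampleCov M)⁻¹ - 1‖ ≤ ‖(sampleCov M)⁻¹‖ * gramDev M := by
  have h1 : (sampleCov M)⁻¹ - 1 = (sampleCov M)⁻¹ * (1 - sampleCov M) := by
    rw [mul_sub, Matrix.nonsing_inv_mul _ h, mul_one]
  rw [h1, gramDev, norm_sub_rev (sampleCov M)]
  exact norm_mul_le _ _

section Portfolio

variable {n p : ℕ} {σ : Fin p → ℝ} {P : Matrix (Fin p) (Fin p) ℝ}

theorem inv_eq_transpose_of_mem_orthogonalGroup (hP : P ∈ Matrix.orthogonalGroup (Fin p) ℝ) :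
    P⁻¹ = Pᵀ :=
  Matrix.inv_eq_left_inv ((Matrix.mem_orthogonalGroup_iff' _ _).1 hP)

theorem inv_transpose_eq_of_mem_orthogonalGroup (hP : P ∈ Matrix.orthogonalGroup (Fin p) ℝ) :
    Pᵀ⁻¹ = P :=
  Matrix.inv_eq_left_inv ((Matrix.mem_orthogonalGroup_iff _ _).1 hP)

theorem inv_diagonal_of_pos (hσ : ∀ k, 0 < σ k) : (diagonal σ)⁻¹ = diagonal fun k => (σ k)⁻¹ := by
  refine Matrix.inv_eq_left_inv ?_
  rw [Matrix.diagonal_mul_diagonal, ← Matrix.diagonal_one]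
  congr 1
  funext k
  exact inv_mul_cancel₀ (hσ k).ne'

theorem isUnit_det_orthogonal (hP : P ∈ Matrix.orthogonalGroup (Fin p) ℝ) : IsUnit P.det :=
  Matrix.isUnit_det_of_left_inverse ((Matrix.mem_orthogonalGroup_iff' _ _).1 hP)

theorem isUnit_det_sampleCov_dataMatrix (hσ : ∀ k, 0 < σ k)
    (hP : P ∈ Matrix.orthogonalGroup (Fin p) ℝ) {M : Matrix (Fin n) (Fin p) ℝ}
    (h : IsUnit (sampleCov M).det) : IsUnit (sampleCov (dataMatrix σ P M)).det := by
  have hD : IsUnit (diagonal σ).det := by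
    rw [Matrix.det_diagonal, isUnit_iff_ne_zero]
    exact (Finset.prod_pos fun k _ => hσ k).ne'
  have hP' := isUnit_det_orthogonal hP
  rw [sampleCov_dataMatrix]
  simp only [Matrix.det_mul, Matrix.det_transpose]
  exact (((hP'.mul hD).mul h).mul hD).mul hP'

theorem inv_trueCov (hσ : ∀ k, 0 < σ k) (hP : P ∈ Matrix.orthogonalGroup (Fin p) ℝ) :
    (trueCov σ P)⁻¹ = Pᵀ * diagonal (fun k => (σ k)⁻¹) * diagonal (fun k => (σ k)⁻¹) * P := by
  rw [trueCov, pow_two, Matrix.mul_inv_rev, Matrix.mul_inv_rev, Matrix.mul_inv_rev,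
    inv_diagonal_of_pos hσ, inv_eq_transpose_of_mem_orthogonalGroup hP,
    inv_transpose_eq_of_mem_orthogonalGroup hP]
  simp only [Matrix.mul_assoc]

theorem inv_sampleCov_dataMatrix (hσ : ∀ k, 0 < σ k) (hP : P ∈ Matrix.orthogonalGroup (Fin p) ℝ)
    (M : Matrix (Fin n) (Fin p) ℝ) :
    (sampleCov (dataMatrix σ P M))⁻¹ = Pᵀ * diagonal (fun k => (σ k)⁻¹) * (sampleCov M)⁻¹ *
      diagonal (fun k => (σ k)⁻¹) * P := by
  rw [sampleCov_dataMatrix, ← sampleCov, Matrix.mul_inv_rev, Matrix.mul_inv_rev,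
    Matrix.mul_inv_rev, Matrix.mul_inv_rev,
    inv_diagonal_of_pos hσ, inv_eq_transpose_of_mem_orthogonalGroup hP,
    inv_transpose_eq_of_mem_orthogonalGroup hP]
  simp only [Matrix.mul_assoc]

theorem freeWeight_sub_freeWeight (hσ : ∀ k, 0 < σ k)
    (hP : P ∈ Matrix.orthogonalGroup (Fin p) ℝ) (M : Matrix (Fin n) (Fin p) ℝ) :
    freeWeight (sampleCov (dataMatrix σ P M)) - freeWeight (trueCov σ P) =
      WithLp.toLp 2 ((Pᵀ * diagonal (fun k => (σ k)⁻¹) * ((sampleCov M)⁻¹ - 1) * diagonal σ * P) *ᵥ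
        (freeWeight (trueCov σ P)).ofLp) := by
  have hPP : P * Pᵀ = 1 := (Matrix.mem_orthogonalGroup_iff _ _).1 hP
  have hDD : diagonal σ * diagonal (fun k => (σ k)⁻¹) = 1 := by
    rw [Matrix.diagonal_mul_diagonal, ← Matrix.diagonal_one]
    congr 1
    funext k
    exact mul_inv_cancel₀ (hσ k).ne'
  have h1 : (Pᵀ * diagonal (fun k => (σ k)⁻¹) * ((sampleCov M)⁻¹ - 1) * diagonal σ * P) *
      (trueCov σ P)⁻¹ = (sampleCov (dataMatrix σ P M))⁻¹ - (trueCov σ P)⁻¹ := by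
    rw [inv_sampleCov_dataMatrix hσ hP, inv_trueCov hσ hP]
    set D' := diagonal (fun k => (σ k)⁻¹)
    calc Pᵀ * D' * ((sampleCov M)⁻¹ - 1) * diagonal σ * P * (Pᵀ * D' * D' * P)
        = Pᵀ * D' * ((sampleCov M)⁻¹ - 1) * (diagonal σ * ((P * Pᵀ) * D')) * D' * P := by
          simp only [Matrix.mul_assoc]
      _ = _ := by
          rw [hPP, Matrix.one_mul, hDD, Matrix.mul_one, Matrix.mul_sub, Matrix.sub_mul,
            Matrix.sub_mul, Matrix.mul_one]
  rw [freeWeight, freeWeight, ← WithLp.toLp_sub, ← Matrix.sub_mulVec, Matrix.mulVec_mulVec, h1]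

theorem norm_le_one_of_mem_orthogonalGroup (hP : P ∈ Matrix.orthogonalGroup (Fin p) ℝ) :
    ‖P‖ ≤ 1 ∧ ‖Pᵀ‖ ≤ 1 := by
  have h1 : ∀ Q : Matrix (Fin p) (Fin p) ℝ, Qᵀ * Q = 1 → ‖Q‖ ≤ 1 := by
    intro Q hQ
    have h2 := Matrix.l2_opNorm_conjTranspose_mul_self Q
    rw [Matrix.conjTranspose_eq_transpose_of_trivial, hQ] at h2
    have h3 : ‖(1 : Matrix (Fin p) (Fin p) ℝ)‖ ≤ 1 := by
      rw [← Matrix.diagonal_one, Matrix.l2_opNorm_diagonal]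
      exact (pi_norm_le_iff_of_nonneg zero_le_one).2 fun _ => by simp
    nlinarith [norm_nonneg Q]
  exact ⟨h1 P ((Matrix.mem_orthogonalGroup_iff' _ _).1 hP),
    h1 Pᵀ (by rw [Matrix.transpose_transpose]; exact (Matrix.mem_orthogonalGroup_iff _ _).1 hP)⟩

theorem iInf_pos_of_pos (hp : 0 < p) (hσ : ∀ k, 0 < σ k) : 0 < ⨅ k, σ k := by
  have : NeZero p := ⟨hp.ne'⟩
  obtain ⟨k, hk⟩ := exists_eq_ciInf_of_finite (f := σ)
  rw [← hk]
  exact hσ k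

theorem norm_diagonal_le_iSup (hσ : ∀ k, 0 < σ k) : ‖diagonal σ‖ ≤ ⨆ k, σ k := by
  rw [Matrix.l2_opNorm_diagonal]
  refine (pi_norm_le_iff_of_nonneg (Real.iSup_nonneg fun k => (hσ k).le)).2 fun k => ?_
  rw [Real.norm_of_nonneg (hσ k).le]
  exact le_ciSup (Set.finite_range σ).bddAbove k

theorem norm_diagonal_inv_le (hp : 0 < p) (hσ : ∀ k, 0 < σ k) :
    ‖diagonal fun k => (σ k)⁻¹‖ ≤ (⨅ k, σ k)⁻¹ := by
  have h0 := iInf_pos_of_pos hp hσ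
  rw [Matrix.l2_opNorm_diagonal]
  refine (pi_norm_le_iff_of_nonneg (by positivity)).2 fun k => ?_
  rw [Real.norm_of_nonneg (inv_nonneg.2 (hσ k).le)]
  exact inv_anti₀ h0 (ciInf_le (Set.finite_range σ).bddBelow k)

theorem sigmaRatio_nonneg (hσ : ∀ k, 0 < σ k) : 0 ≤ sigmaRatio σ :=
  div_nonneg (Real.iSup_nonneg fun k => (hσ k).le) (Real.iInf_nonneg fun k => (hσ k).le)

theorem norm_freeWeight_sub_le (hp : 0 < p) (hσ : ∀ k, 0 < σ k)
    (hP : P ∈ Matrix.orthogonalGroup (Fin p) ℝ) {M : Matrix (Fin n) (Fin p) ℝ}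
    (h : IsUnit (sampleCov M).det) :
    ‖freeWeight (sampleCov (dataMatrix σ P M)) - freeWeight (trueCov σ P)‖ ≤
      ‖freeWeight (trueCov σ P)‖ * sigmaRatio σ * (‖(sampleCov M)⁻¹‖ * gramDev M) := by
  obtain ⟨hP1, hP2⟩ := norm_le_one_of_mem_orthogonalGroup hP
  have hD := norm_diagonal_le_iSup hσ
  have hD' := norm_diagonal_inv_le hp hσ
  have h0 := iInf_pos_of_pos hp hσ
  have hs0 : 0 ≤ ⨆ k, σ k := Real.iSup_nonneg fun k => (hσ k).le
  have hW := norm_inv_sub_one_le h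
  have hg := gramDev_nonneg M
  rw [freeWeight_sub_freeWeight hσ hP]
  refine (Matrix.l2_opNorm_mulVec _ _).trans ?_
  have h1 : ‖Pᵀ * diagonal (fun k => (σ k)⁻¹) * ((sampleCov M)⁻¹ - 1) * diagonal σ * P‖ ≤
      1 * (⨅ k, σ k)⁻¹ * (‖(sampleCov M)⁻¹‖ * gramDev M) * (⨆ k, σ k) * 1 := by
    refine (norm_mul_le _ _).trans ?_
    gcongr
    refine (norm_mul_le _ _).trans ?_
    gcongr
    refine (norm_mul_le _ _).trans ?_
    gcongr
    refine (norm_mul_le _ _).trans ?_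
    gcongr
  refine (mul_le_mul_of_nonneg_right h1 (norm_nonneg _)).trans (le_of_eq ?_)
  rw [sigmaRatio]
  ring

theorem norm_freeWeight_trueCov_le (hp : 0 < p) (hσ : ∀ k, 0 < σ k)
    (hP : P ∈ Matrix.orthogonalGroup (Fin p) ℝ) :
    ‖freeWeight (trueCov σ P)‖ ≤ (⨅ k, σ k) ^ (-2 : ℤ) * p := by
  obtain ⟨hP1, hP2⟩ := norm_le_one_of_mem_orthogonalGroup hP
  have hD' := norm_diagonal_inv_le hp hσ
  have h0 := iInf_pos_of_pos hp hσ
  have h1 : ‖(trueCov σ P)⁻¹‖ ≤ 1 * (⨅ k, σ k)⁻¹ * (⨅ k, σ k)⁻¹ * 1 := by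
    rw [inv_trueCov hσ hP]
    refine (norm_mul_le _ _).trans ?_
    gcongr
    refine (norm_mul_le _ _).trans ?_
    gcongr
    refine (norm_mul_le _ _).trans ?_
    gcongr
  have h2 : ‖(WithLp.toLp 2 fun _ => 1 : EuclideanSpace ℝ (Fin p))‖ ≤ p := by
    rw [EuclideanSpace.norm_eq]
    simp only [norm_one, one_pow, Finset.sum_const, Finset.card_univ, Fintype.card_fin,
      nsmul_eq_mul, mul_one]
    rw [Real.sqrt_le_left (by positivity)]
    have : (1 : ℝ) ≤ p := by exact_mod_cast hp
    nlinarith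
  have h3 : ‖freeWeight (trueCov σ P)‖ ≤
      ‖(trueCov σ P)⁻¹‖ * ‖(WithLp.toLp 2 fun _ => 1 : EuclideanSpace ℝ (Fin p))‖ :=
    Matrix.l2_opNorm_mulVec (trueCov σ P)⁻¹ (WithLp.toLp 2 fun _ => 1)
  refine h3.trans ((mul_le_mul h1 h2 (norm_nonneg _) (by positivity)).trans (le_of_eq ?_))
  generalize (⨅ k, σ k) = m
  rw [_root_.zpow_neg, show (2 : ℤ) = ((2 : ℕ) : ℤ) by norm_num, zpow_natCast]
  ring

theorem measurable_norm_inv_sampleCov :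
    Measurable fun e : Fin n × Fin p → ℝ => ‖(sampleCov (toMat e))⁻¹‖ := by
  have hc : Continuous fun e : Fin n × Fin p → ℝ => sampleCov (toMat e) :=
    continuous_sampleCov.comp continuous_toMat
  simp_rw [Matrix.inv_def, norm_smul, Ring.inverse_eq_inv', norm_inv]
  exact hc.matrix_det.norm.measurable.inv.mul hc.matrix_adjugate.norm.measurable

theorem measurable_norm_freeWeight_sub (σ : Fin p → ℝ) (P : Matrix (Fin p) (Fin p) ℝ)
    (w : EuclideanSpace ℝ (Fin p)) :
    Measurable fun e : Fin n × Fin p → ℝ =>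
      ‖freeWeight (sampleCov (dataMatrix σ P (toMat e))) - w‖ := by
  have hc : Continuous fun e : Fin n × Fin p → ℝ => sampleCov (dataMatrix σ P (toMat e)) := by
    refine continuous_sampleCov.comp ?_
    unfold dataMatrix
    exact (continuous_toMat.matrix_mul continuous_const).matrix_mul continuous_const
  have h1 : Continuous fun e : Fin n × Fin p → ℝ =>
      (WithLp.toLp 2 ((sampleCov (dataMatrix σ P (toMat e))).adjugate *ᵥ fun _ => 1) :
        EuclideanSpace ℝ (Fin p)) :=
    (PiLp.continuous_toLp 2 _).comp (hc.matrix_adjugate.matrix_mulVec continuous_const)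
  simp_rw [freeWeight, Matrix.inv_def, Matrix.smul_mulVec, WithLp.toLp_smul, Ring.inverse_eq_inv']
  exact ((hc.matrix_det.measurable.inv.smul h1.measurable).sub_const w).norm

end Portfolio

theorem measurable_gramDev_toMat {n p : ℕ} :
    Measurable fun e : Fin n × Fin p → ℝ => gramDev (toMat e) :=
  (continuous_gramDev.comp continuous_toMat).measurable

/-- `√(n / p) * gramDev / 12`, the deviation on its natural scale. -/
noncomputable def scaledDev {n p : ℕ} (e : Fin n × Fin p → ℝ) : ℝ :=
  √((n : ℝ) / p) * gramDev (toMat e) / 12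

theorem scaledDev_nonneg {n p : ℕ} (e : Fin n × Fin p → ℝ) : 0 ≤ scaledDev e := by
  have := gramDev_nonneg (toMat e)
  unfold scaledDev
  positivity

theorem measurable_scaledDev {n p : ℕ} :
    Measurable (scaledDev : (Fin n × Fin p → ℝ) → ℝ) :=
  (measurable_gramDev_toMat.const_mul _).div_const _

theorem gramDev_eq_scaledDev {n p : ℕ} (hn : 0 < n) (hp : 0 < p) (e : Fin n × Fin p → ℝ) :
    gramDev (toMat e) = 12 * scaledDev e * √((p : ℝ) / n) := by
  have hn' : (0 : ℝ) < n := by exact_mod_cast hn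
  have hp' : (0 : ℝ) < p := by exact_mod_cast hp
  have : √((n : ℝ) / p) * √((p : ℝ) / n) = 1 := by
    rw [← Real.sqrt_mul (by positivity), show (n : ℝ) / p * (p / n) = 1 by field_simp,
      Real.sqrt_one]
  rw [scaledDev]
  linear_combination (-gramDev (toMat e)) * this

theorem lintegral_exp_scaledDev_le {n p : ℕ} (hp : 0 < p) (hpn : p ≤ n) :
    ∫⁻ e, ENNReal.ofReal (Real.exp (p * scaledDev e)) ∂(stdGaussianEntries n p) ≤
      ENNReal.ofReal (Real.exp (5 * p)) := by
  have hn : 0 < n := hp.trans_le hpn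
  have hn' : (0 : ℝ) < n := by exact_mod_cast hn
  have hp' : (0 : ℝ) < p := by exact_mod_cast hp
  have hpn' : (p : ℝ) ≤ n := by exact_mod_cast hpn
  set θ : ℝ := p * √((n : ℝ) / p) / 6 with hθ
  have hsq : θ ^ 2 = p * n / 36 := by
    rw [hθ, div_pow, mul_pow, Real.sq_sqrt (by positivity)]
    field_simp
    norm_num
  have h1 : θ ≤ n / 6 := by
    refine abs_le_of_sq_le_sq' ?_ (by positivity) |>.2
    rw [hsq, div_pow]
    nlinarith
  have h2 := lintegral_exp_half_gramDev_le (p := p) hn hp (by positivity) h1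
  have h3 : ∀ e : Fin n × Fin p → ℝ, θ * (gramDev (toMat e) / 2) = p * scaledDev e := by
    intro e; rw [hθ, scaledDev]; ring
  simp_rw [h3] at h2
  refine h2.trans (ENNReal.ofReal_le_ofReal ?_)
  have h4 : 4 * θ ^ 2 / n = p * (1 / 9) := by rw [hsq]; field_simp; norm_num
  rw [h4, Real.exp_nat_mul, mul_comm (5 : ℝ), Real.exp_nat_mul]
  have h5 : (2 : ℝ) ≤ 2 ^ p := by simpa using pow_le_pow_right₀ (by norm_num : (1 : ℝ) ≤ 2) hp
  calc 2 * 9 ^ p * Real.exp (1 / 9) ^ p ≤ 2 ^ p * 9 ^ p * Real.exp (1 / 9) ^ p := by gcongr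
    _ = (2 * 9 * Real.exp (1 / 9)) ^ p := by rw [mul_pow, mul_pow]
    _ ≤ Real.exp 5 ^ p := by
      gcongr
      have h6 : Real.exp 5 = Real.exp 1 ^ 5 := by rw [← Real.exp_nat_mul]; norm_num
      have h7 : (2.7 : ℝ) ^ 5 ≤ Real.exp 1 ^ 5 := by
        gcongr; linarith [Real.exp_one_gt_d9]
      have h8 : Real.exp (1 / 9) ≤ Real.exp 1 := Real.exp_le_exp.2 (by norm_num)
      have := Real.exp_one_lt_three
      norm_num at h7
      linarith

theorem measure_scaledDev_gt_le {n p : ℕ} (hp : 0 < p) (hpn : p ≤ n) (A : ℝ) :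
    stdGaussianEntries n p {e | A + 6 < scaledDev e} ≤
      ENNReal.ofReal (Real.exp (-(A * p)) / 2) := by
  have hp' : (1 : ℝ) ≤ p := by exact_mod_cast hp
  have h1 := mul_meas_ge_le_lintegral (μ := stdGaussianEntries n p)
    ((Real.measurable_exp.comp ((measurable_scaledDev (n := n) (p := p)).const_mul
      (p : ℝ))).ennreal_ofReal) (ENNReal.ofReal (Real.exp (p * (A + 6))))
  have h2 : stdGaussianEntries n p {e | A + 6 < scaledDev e} ≤ stdGaussianEntries n p
      {e | ENNReal.ofReal (Real.exp (p * (A + 6))) ≤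
        ENNReal.ofReal (Real.exp (p * scaledDev e))} := by
    refine measure_mono fun e he => ENNReal.ofReal_le_ofReal (Real.exp_le_exp.2 ?_)
    have : A + 6 < scaledDev e := he
    gcongr
  have h3 : ENNReal.ofReal (Real.exp (p * (A + 6))) ≠ 0 := by
    rw [ne_eq, ENNReal.ofReal_eq_zero, not_le]; positivity
  rw [← ENNReal.mul_le_mul_iff_right h3 ENNReal.ofReal_ne_top,
    ← ENNReal.ofReal_mul (by positivity)]
  refine (mul_le_mul_right h2 _).trans (h1.trans ((lintegral_exp_scaledDev_le hp hpn).trans ?_))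
  apply ENNReal.ofReal_le_ofReal
  rw [← mul_div_assoc, ← Real.exp_add, le_div_iff₀ two_pos]
  have h4 : (2 : ℝ) ≤ Real.exp p := by linarith [Real.add_one_le_exp (p : ℝ)]
  calc Real.exp (5 * p) * 2 ≤ Real.exp (5 * p) * Real.exp p := by gcongr
    _ = Real.exp (p * (A + 6) + -(A * p)) := by rw [← Real.exp_add]; congr 1; ring

theorem lintegral_scaledDev_sq_le {n p : ℕ} (hp : 0 < p) (hpn : p ≤ n) :
    ∫⁻ e, ENNReal.ofReal (scaledDev e ^ 2) ∂(stdGaussianEntries n p) ≤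
      ENNReal.ofReal (4 * Real.exp 5) := by
  have hp' : (1 : ℝ) ≤ p := by exact_mod_cast hp
  have hpt : ∀ e : Fin n × Fin p → ℝ, ENNReal.ofReal (scaledDev e ^ 2) ≤
      ENNReal.ofReal (2 * Real.exp 5) + ENNReal.ofReal (2 * Real.exp 5 * Real.exp (-(5 * p))) *
        ENNReal.ofReal (Real.exp (p * scaledDev e)) := by
    intro e
    rw [← ENNReal.ofReal_mul (by positivity), ← ENNReal.ofReal_add (by positivity) (by positivity)]
    apply ENNReal.ofReal_le_ofReal
    have h0 := scaledDev_nonneg e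
    set y := scaledDev e
    have h1 := Real.quadratic_le_exp_of_nonneg h0
    have h2 : Real.exp y ≤ Real.exp 5 * (1 + Real.exp (p * (y - 5))) := by
      rw [show Real.exp y = Real.exp 5 * Real.exp (y - 5) by rw [← Real.exp_add]; ring_nf]
      gcongr
      rcases le_total y 5 with h | h
      · have : Real.exp (y - 5) ≤ 1 := Real.exp_le_one_iff.2 (by linarith)
        linarith [Real.exp_pos (p * (y - 5))]
      · have : Real.exp (y - 5) ≤ Real.exp (p * (y - 5)) := Real.exp_le_exp.2 (by nlinarith)
        linarith
    have h3 : Real.exp (p * (y - 5)) = Real.exp (-(5 * p)) * Real.exp (p * y) := by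
      rw [← Real.exp_add]; ring_nf
    rw [h3] at h2
    linarith
  refine (lintegral_mono hpt).trans ?_
  rw [lintegral_add_left measurable_const, lintegral_const_mul' _ _ ENNReal.ofReal_ne_top,
    lintegral_const, measure_univ, mul_one]
  refine (add_le_add_right (mul_le_mul_right (lintegral_exp_scaledDev_le hp hpn) _) _).trans ?_
  rw [← ENNReal.ofReal_mul (by positivity), ← ENNReal.ofReal_add (by positivity) (by positivity)]
  apply ENNReal.ofReal_le_ofReal
  rw [mul_assoc _ (Real.exp (-(5 * (p : ℝ)))), ← Real.exp_add]
  simp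
  linarith

/-- The threshold at which `1000 ^ n * τ ^ (n - p)` drops below `b ^ n` when `p ≤ γ n`. -/
noncomputable def threshold (γ b : ℝ) : ℝ := (b / 1000) ^ (1 - γ)⁻¹

theorem threshold_pos {γ b : ℝ} (hb : 0 < b) : 0 < threshold γ b :=
  Real.rpow_pos_of_pos (by positivity) _

theorem threshold_le {γ b : ℝ} (h0 : 0 < γ) (h1 : γ < 1) (hb : 0 < b) (hb1 : b ≤ 1) :
    threshold γ b ≤ 1 / 1000 := by
  have h2 : 1 ≤ (1 - γ)⁻¹ := (one_le_inv₀ (by linarith)).2 (by linarith)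
  calc threshold γ b ≤ (b / 1000) ^ (1 : ℝ) :=
        Real.rpow_le_rpow_of_exponent_ge (by positivity) (by linarith) h2
    _ ≤ 1 / 1000 := by rw [Real.rpow_one]; linarith

theorem le_of_le_mul {γ : ℝ} (h1 : γ < 1) {n p : ℕ} (hpn : (p : ℝ) ≤ γ * n) : p ≤ n := by
  have : (p : ℝ) ≤ n := hpn.trans (mul_le_of_le_one_left (by positivity) h1.le)
  exact_mod_cast this

theorem pow_mul_threshold_pow_le {γ b : ℝ} (h0 : 0 < γ) (h1 : γ < 1) (hb : 0 < b) (hb1 : b ≤ 1)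
    {n p : ℕ} (hpn : (p : ℝ) ≤ γ * n) :
    1000 ^ n * threshold γ b ^ (n - p) ≤ b ^ n := by
  have hle := le_of_le_mul h1 hpn
  have ht := threshold_pos (γ := γ) hb
  have hcast : ((n - p : ℕ) : ℝ) = n - p := by rw [Nat.cast_sub hle]
  have h2 : threshold γ b ^ (n - p) ≤ (b / 1000) ^ n := by
    calc threshold γ b ^ (n - p) = threshold γ b ^ ((n - p : ℕ) : ℝ) := (Real.rpow_natCast _ _).symm
      _ ≤ threshold γ b ^ ((1 - γ) * n) := by
        apply Real.rpow_le_rpow_of_exponent_ge ht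
        · linarith [threshold_le h0 h1 hb hb1]
        · rw [hcast]; linarith
      _ = (b / 1000) ^ n := by
        rw [threshold, ← Real.rpow_mul (by positivity), inv_mul_cancel_left₀ (by linarith),
          Real.rpow_natCast]
  calc 1000 ^ n * threshold γ b ^ (n - p) ≤ 1000 ^ n * (b / 1000) ^ n := by gcongr
    _ = b ^ n := by rw [← mul_pow]; congr 1; field_simp

theorem measure_smallSingularSet_threshold_le {γ b u : ℝ} (h0 : 0 < γ) (h1 : γ < 1) (hb : 0 < b)
    (hb1 : b ≤ 1) (hu : 0 < u) (hu1 : u ≤ 1) {n p : ℕ} (hp : 0 < p) (hpn : (p : ℝ) ≤ γ * n) :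
    stdGaussianEntries n p (smallSingularSet n p (threshold γ b * u)) ≤
      ENNReal.ofReal (b ^ n * u ^ (n - p)) := by
  have ht := threshold_pos (γ := γ) hb
  have ht1 := threshold_le h0 h1 hb hb1
  have h2 : threshold γ b * u ≤ 1 / 1000 := (mul_le_of_le_one_right ht.le hu1).trans ht1
  have h3 : 0 < threshold γ b * u := by positivity
  refine (measure_smallSingularSet_le hp (le_of_le_mul h1 hpn) h3 (by nlinarith)).trans ?_
  apply ENNReal.ofReal_le_ofReal
  rw [mul_pow, ← mul_assoc]
  gcongr
  exact pow_mul_threshold_pow_le h0 h1 hb hb1 hpn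

theorem measure_smallSingularSet_dyadic_le {γ : ℝ} (h0 : 0 < γ) (h1 : γ < 1) {n p : ℕ} (hp : 0 < p)
    (hpn : (p : ℝ) ≤ γ * n) (hn : 12 ≤ (1 - γ) * n) (k : ℕ) :
    stdGaussianEntries n p (smallSingularSet n p (threshold γ 1 * (1 / 2) ^ k)) ≤
      ENNReal.ofReal ((1 / 4096) ^ k) := by
  refine (measure_smallSingularSet_threshold_le h0 h1 one_pos le_rfl (by positivity)
    (pow_le_one₀ (by norm_num) (by norm_num)) hp hpn).trans ?_
  apply ENNReal.ofReal_le_ofReal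
  have hle := le_of_le_mul h1 hpn
  have h2 : 12 ≤ n - p := by
    have : ((12 : ℕ) : ℝ) ≤ ((n - p : ℕ) : ℝ) := by
      rw [Nat.cast_sub hle]; push_cast; linarith
    exact_mod_cast this
  rw [one_pow, one_mul]
  calc ((1 / 2 : ℝ) ^ k) ^ (n - p) ≤ ((1 / 2) ^ k) ^ 12 :=
        pow_le_pow_of_le_one (by positivity) (pow_le_one₀ (by norm_num) (by norm_num)) h2
    _ = (1 / 4096) ^ k := by rw [← pow_mul, mul_comm, pow_mul]; norm_num

theorem tsum_pow_mul_half_pow_le :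
    ∑' k : ℕ, ENNReal.ofReal (256 ^ (k + 1)) * ENNReal.ofReal ((1 / 4096) ^ k) ≤
      ENNReal.ofReal 512 := by
  have h : ∀ k : ℕ, ENNReal.ofReal (256 ^ (k + 1)) * ENNReal.ofReal ((1 / 4096) ^ k) ≤
      ENNReal.ofReal 256 * 2⁻¹ ^ k := by
    intro k
    have h2 : (2⁻¹ : ENNReal) ^ k = ENNReal.ofReal ((1 / 2) ^ k) := by
      rw [ENNReal.ofReal_pow (by norm_num), one_div, ENNReal.ofReal_inv_of_pos two_pos]
      simp
    rw [h2, ← ENNReal.ofReal_mul (by positivity), ← ENNReal.ofReal_mul (by positivity)]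
    apply ENNReal.ofReal_le_ofReal
    rw [pow_succ, mul_right_comm, ← mul_pow, mul_comm]
    gcongr
    norm_num
  refine (ENNReal.tsum_le_tsum h).trans ?_
  rw [ENNReal.tsum_mul_left, ENNReal.tsum_geometric, ENNReal.one_sub_inv_two, inv_inv,
    show (2 : ENNReal) = ENNReal.ofReal 2 by simp, ← ENNReal.ofReal_mul (by norm_num)]
  norm_num

theorem ae_exists_notMem_smallSingularSet {γ : ℝ} (h0 : 0 < γ) (h1 : γ < 1) {n p : ℕ} (hp : 0 < p)
    (hpn : (p : ℝ) ≤ γ * n) (hn : 12 ≤ (1 - γ) * n) :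
    ∀ᵐ e ∂(stdGaussianEntries n p),
      ∃ k : ℕ, e ∉ smallSingularSet n p (threshold γ 1 * (1 / 2) ^ k) := by
  have h := ae_eventually_notMem (μ := stdGaussianEntries n p)
    (s := fun k : ℕ => smallSingularSet n p (threshold γ 1 * (1 / 2) ^ k)) ?_
  · filter_upwards [h] with e he using he.exists
  · refine ne_top_of_le_ne_top ENNReal.ofReal_ne_top
      ((ENNReal.tsum_le_tsum fun k => ?_).trans tsum_pow_mul_half_pow_le)
    refine (measure_smallSingularSet_dyadic_le h0 h1 hp hpn hn k).trans ?_
    refine le_mul_of_one_le_left zero_le ?_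
    rw [ENNReal.one_le_ofReal]
    exact one_le_pow₀ (by norm_num)

theorem lintegral_norm_inv_sq_le {γ : ℝ} (h0 : 0 < γ) (h1 : γ < 1) {n p : ℕ} (hp : 0 < p)
    (hpn : (p : ℝ) ≤ γ * n) (hn : 12 ≤ (1 - γ) * n) :
    ∫⁻ e, ENNReal.ofReal (‖(sampleCov (toMat e))⁻¹‖ ^ 2) ∂(stdGaussianEntries n p) ≤
      ENNReal.ofReal (513 * (threshold γ 1 ^ 8)⁻¹) := by
  have ht := threshold_pos (γ := γ) one_pos
  have hn0 : 0 < n := hp.trans_le (le_of_le_mul h1 hpn)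
  set ν := stdGaussianEntries n p
  let B : ℕ → Set (Fin n × Fin p → ℝ) := fun k =>
    smallSingularSet n p (threshold γ 1 * (1 / 2) ^ k)
  let G : (Fin n × Fin p → ℝ) → ENNReal := fun e =>
    1 + ∑' k : ℕ, (toMeasurable ν (B k)).indicator (fun _ => ENNReal.ofReal (256 ^ (k + 1))) e
  have hpt : ∀ᵐ e ∂ν, ENNReal.ofReal (‖(sampleCov (toMat e))⁻¹‖ ^ 2) ≤
      ENNReal.ofReal ((threshold γ 1 ^ 8)⁻¹) * G e := by
    filter_upwards [ae_exists_notMem_smallSingularSet h0 h1 hp hpn hn] with e he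
    classical
    have hk := Nat.find_spec he
    have hmin := fun m => Nat.find_min he (m := m)
    generalize Nat.find he = k at hk hmin
    have h2 := norm_inv_le_of_notMem hn0 (by positivity) hk
    have h3 : ‖(sampleCov (toMat e))⁻¹‖ ^ 2 ≤ (threshold γ 1 ^ 8)⁻¹ * 256 ^ k := by
      calc _ ≤ (((threshold γ 1 * (1 / 2) ^ k) ^ 4)⁻¹) ^ 2 := by gcongr
        _ = _ := by
          rw [inv_pow, ← pow_mul, mul_pow, mul_inv, pow_right_comm (1 / 2 : ℝ) k, ← inv_pow _ k]
          norm_num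
    have h4 : ENNReal.ofReal (256 ^ k) ≤ G e := by
      cases k with
      | zero => simp [G]
      | succ m =>
        have h5 : e ∈ toMeasurable ν (B m) := by
          have := hmin m (Nat.lt_succ_self m)
          exact subset_toMeasurable _ _ (not_not.1 this)
        refine le_trans ?_ le_add_self
        refine le_trans ?_ (ENNReal.le_tsum m)
        rw [Set.indicator_of_mem h5]
    refine (ENNReal.ofReal_le_ofReal h3).trans ?_
    rw [ENNReal.ofReal_mul (by positivity)]
    gcongr
  refine (lintegral_mono_ae hpt).trans ?_
  rw [lintegral_const_mul' _ _ ENNReal.ofReal_ne_top, mul_comm (513 : ℝ),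
    ENNReal.ofReal_mul (by positivity)]
  refine mul_le_mul_right ?_ _
  simp only [G]
  rw [lintegral_add_left measurable_const, lintegral_const, measure_univ, mul_one,
    lintegral_tsum fun k => (measurable_const.indicator (measurableSet_toMeasurable _ _)).aemeasurable]
  have h6 : ∀ k : ℕ, ∫⁻ e, (toMeasurable ν (B k)).indicator
      (fun _ => ENNReal.ofReal (256 ^ (k + 1))) e ∂ν ≤
      ENNReal.ofReal (256 ^ (k + 1)) * ENNReal.ofReal ((1 / 4096) ^ k) := by
    intro k
    rw [lintegral_indicator_const (measurableSet_toMeasurable _ _), measure_toMeasurable]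
    exact mul_le_mul_right (measure_smallSingularSet_dyadic_le h0 h1 hp hpn hn k) _
  refine (add_le_add_right ((ENNReal.tsum_le_tsum h6).trans tsum_pow_mul_half_pow_le) _).trans ?_
  rw [← ENNReal.ofReal_one, ← ENNReal.ofReal_add (by norm_num) (by norm_num)]
  norm_num

/-- The entries for which the sample covariance is invertible and the free weight is estimated
within `C` times the rate `‖S_Σ‖ (σ_max / σ_min) √(p / n)`. -/
def accurateSet {n p : ℕ} (σ : Fin p → ℝ) (P : Matrix (Fin p) (Fin p) ℝ) (C : ℝ) :
    Set (Fin n × Fin p → ℝ) :=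
  {e | IsUnit (sampleCov (dataMatrix σ P (toMat e))).det ∧
    ‖freeWeight (sampleCov (dataMatrix σ P (toMat e))) - freeWeight (trueCov σ P)‖ ≤
      C * (‖freeWeight (trueCov σ P)‖ * sigmaRatio σ * √((p : ℝ) / n))}

theorem exists_measure_compl_accurateSet_le {γ : ℝ} (h0 : 0 < γ) (h1 : γ < 1) {A : ℝ}
    (hA : 0 < A) : ∃ C : ℝ, 0 < C ∧ ∀ (n p : ℕ), 0 < p → (p : ℝ) ≤ γ * n →
      ∀ (σ : Fin p → ℝ), (∀ k, 0 < σ k) →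
      ∀ (P : Matrix (Fin p) (Fin p) ℝ), P ∈ Matrix.orthogonalGroup (Fin p) ℝ →
        stdGaussianEntries n p (accurateSet σ P C)ᶜ ≤ ENNReal.ofReal (Real.exp (-(A * p))) := by
  set b := Real.exp (-A) / 2 with hb
  have hb0 : 0 < b := by positivity
  have hA1 : Real.exp (-A) ≤ 1 := Real.exp_le_one_iff.2 (by linarith)
  have hb1 : b ≤ 1 := by linarith
  have hτ := threshold_pos (γ := γ) hb0
  refine ⟨(threshold γ b ^ 4)⁻¹ * (12 * (A + 6)), by positivity, ?_⟩
  intro n p hp hpn σ hσ P hP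
  have hle := le_of_le_mul h1 hpn
  have hn : 0 < n := hp.trans_le hle
  have hsub : (accurateSet σ P ((threshold γ b ^ 4)⁻¹ * (12 * (A + 6))))ᶜ ⊆
      smallSingularSet n p (threshold γ b * 1) ∪ {e | A + 6 < scaledDev e} := by
    rw [Set.compl_subset_comm]
    intro e he
    rw [mul_one, Set.compl_union] at he
    obtain ⟨he1, he2⟩ := he
    have he2' : scaledDev e ≤ A + 6 := not_lt.1 he2
    have hu := isUnit_det_of_notMem hn hτ he1
    refine ⟨isUnit_det_sampleCov_dataMatrix hσ hP hu, ?_⟩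
    refine (norm_freeWeight_sub_le hp hσ hP hu).trans ?_
    have hV := norm_inv_le_of_notMem hn hτ he1
    have hr := sigmaRatio_nonneg hσ
    have hL : gramDev (toMat e) ≤ 12 * (A + 6) * √((p : ℝ) / n) := by
      rw [gramDev_eq_scaledDev hn hp]; gcongr
    have hg := gramDev_nonneg (toMat e)
    calc ‖freeWeight (trueCov σ P)‖ * sigmaRatio σ *
          (‖(sampleCov (toMat e))⁻¹‖ * gramDev (toMat e))
        ≤ ‖freeWeight (trueCov σ P)‖ * sigmaRatio σ *
          ((threshold γ b ^ 4)⁻¹ * (12 * (A + 6) * √((p : ℝ) / n))) := by gcongr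
      _ = _ := by ring
  refine (measure_mono hsub).trans ((measure_union_le _ _).trans ?_)
  refine (add_le_add (measure_smallSingularSet_threshold_le h0 h1 hb0 hb1 one_pos le_rfl hp hpn)
    (measure_scaledDev_gt_le hp hle A)).trans ?_
  rw [← ENNReal.ofReal_add (by positivity) (by positivity)]
  apply ENNReal.ofReal_le_ofReal
  have h2 : b ^ n * 1 ^ (n - p) ≤ Real.exp (-(A * p)) / 2 := by
    have h3 : Real.exp (-(A * p)) = Real.exp (-A) ^ p := by
      rw [← Real.exp_nat_mul]; congr 1; ring
    rw [one_pow, mul_one, h3, hb, div_pow]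
    have h4 : (2 : ℝ) ≤ 2 ^ n := by simpa using pow_le_pow_right₀ (by norm_num : (1 : ℝ) ≤ 2) hn
    gcongr ?_ / ?_
    exact pow_le_pow_of_le_one (by positivity) hA1 hle
  linarith

theorem lintegral_norm_freeWeight_sub_le {γ : ℝ} (h0 : 0 < γ) (h1 : γ < 1) {n p : ℕ} (hp : 0 < p)
    (hpn : (p : ℝ) ≤ γ * n) (hn : 12 ≤ (1 - γ) * n) {σ : Fin p → ℝ} (hσ : ∀ k, 0 < σ k)
    {P : Matrix (Fin p) (Fin p) ℝ} (hP : P ∈ Matrix.orthogonalGroup (Fin p) ℝ) :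
    ∫⁻ e, ENNReal.ofReal
        ‖freeWeight (sampleCov (dataMatrix σ P (toMat e))) - freeWeight (trueCov σ P)‖
      ∂(stdGaussianEntries n p) ≤
    ENNReal.ofReal ((513 * (threshold γ 1 ^ 8)⁻¹ + 144 * (4 * Real.exp 5)) *
      (‖freeWeight (trueCov σ P)‖ * sigmaRatio σ * √((p : ℝ) / n))) := by
  have hle := le_of_le_mul h1 hpn
  have hn0 : 0 < n := hp.trans_le hle
  have ht := threshold_pos (γ := γ) one_pos
  have hr := sigmaRatio_nonneg hσ
  set R := ‖freeWeight (trueCov σ P)‖ * sigmaRatio σ * √((p : ℝ) / n) with hR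
  have hR0 : 0 ≤ R := by positivity
  have hpt : ∀ᵐ e ∂(stdGaussianEntries n p), ENNReal.ofReal
      ‖freeWeight (sampleCov (dataMatrix σ P (toMat e))) - freeWeight (trueCov σ P)‖ ≤
      ENNReal.ofReal R * (ENNReal.ofReal (‖(sampleCov (toMat e))⁻¹‖ ^ 2) +
        ENNReal.ofReal 144 * ENNReal.ofReal (scaledDev e ^ 2)) := by
    filter_upwards [ae_exists_notMem_smallSingularSet h0 h1 hp hpn hn] with e he
    obtain ⟨k, hk⟩ := he
    have hu := isUnit_det_of_notMem hn0 (by positivity) hk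
    rw [← ENNReal.ofReal_mul (by norm_num), ← ENNReal.ofReal_add (by positivity) (by positivity),
      ← ENNReal.ofReal_mul hR0]
    refine ENNReal.ofReal_le_ofReal ((norm_freeWeight_sub_le hp hσ hP hu).trans ?_)
    rw [gramDev_eq_scaledDev hn0 hp]
    set V := ‖(sampleCov (toMat e))⁻¹‖
    have h2 : V * (12 * scaledDev e) ≤ V ^ 2 + 144 * scaledDev e ^ 2 := by
      nlinarith [sq_nonneg (V - 12 * scaledDev e), sq_nonneg (V + 12 * scaledDev e)]
    calc _ = R * (V * (12 * scaledDev e)) := by rw [hR]; ring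
      _ ≤ _ := by gcongr
  refine (lintegral_mono_ae hpt).trans ?_
  rw [lintegral_const_mul' _ _ ENNReal.ofReal_ne_top,
    lintegral_add_left (measurable_norm_inv_sampleCov.pow_const 2).ennreal_ofReal,
    lintegral_const_mul' _ _ ENNReal.ofReal_ne_top, mul_comm _ R, ENNReal.ofReal_mul hR0,
    ENNReal.ofReal_add (by positivity) (by positivity), ENNReal.ofReal_mul (p := 144) (by norm_num)]
  gcongr
  · exact lintegral_norm_inv_sq_le h0 h1 hp hpn hn
  · exact lintegral_scaledDev_sq_le hp hle

end

theorem HasLaw.one_sub_le_measureReal_preimage {Ω X : Type*} [MeasurableSpace Ω]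
    [MeasurableSpace X] {μ : Measure Ω} [IsProbabilityMeasure μ] {ν : Measure X} {f : Ω → X}
    (hf : HasLaw f ν μ) {s : Set X} {δ : ℝ} (hδ : 0 ≤ δ) (hs : ν sᶜ ≤ ENNReal.ofReal δ) :
    1 - δ ≤ μ.real (f ⁻¹' s) := by
  have h1 : μ (f ⁻¹' s)ᶜ ≤ ENNReal.ofReal δ := by
    rw [← Set.preimage_compl]
    refine (Measure.le_map_apply hf.aemeasurable _).trans ?_
    rwa [hf.map_eq]
  have h2 : μ.real (f ⁻¹' s)ᶜ ≤ δ := ENNReal.toReal_le_of_le_ofReal hδ h1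
  have h3 := measureReal_union_le (μ := μ) (f ⁻¹' s) (f ⁻¹' s)ᶜ
  rw [Set.union_compl_self, probReal_univ] at h3
  linarith

theorem exists_forall_one_sub_exp_le_measureReal {γ : ℝ} (hγ0 : 0 < γ) (hγ1 : γ < 1) {A : ℝ}
    (hA : 0 < A) : ∃ C : ℝ, 0 < C ∧
      ∀ (n p : ℕ), 0 < p → (p : ℝ) ≤ γ * n →
      ∀ (σ : Fin p → ℝ), (∀ k, 0 < σ k) →
      ∀ (P : Matrix (Fin p) (Fin p) ℝ), P ∈ Matrix.orthogonalGroup (Fin p) ℝ →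
      ∀ (Ω : Type*) [MeasurableSpace Ω] (μ : Measure Ω) [IsProbabilityMeasure μ]
        (N : Ω → Matrix (Fin n) (Fin p) ℝ), IsStdGaussianMatrix μ N →
        1 - Real.exp (-(A * p)) ≤ μ.real {ω |
          IsUnit (sampleCov (dataMatrix σ P (N ω))).det ∧
          ‖freeWeight
                (sampleCov (dataMatrix σ P (N ω)))
              - freeWeight (trueCov σ P)‖
            ≤ C * (‖freeWeight (trueCov σ P)‖
                * sigmaRatio σ * Real.sqrt ((p : ℝ) / n))} := by
  obtain ⟨C, hC, h⟩ := exists_measure_compl_accurateSet_le hγ0 hγ1 hA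
  refine ⟨C, hC, fun n p hp hpn σ hσ P hP Ω _ μ _ N hN => ?_⟩
  exact HasLaw.one_sub_le_measureReal_preimage hN.hasLaw (Real.exp_pos _).le
    (h n p hp hpn σ hσ P hP)

end MinVarPortfolio

theorem mainTheorem1 (γ : ℝ) (hγ0 : 0 < γ) (hγ1 : γ < 1) :
    -- bound with probability at least `1 - exp (-A p)`
    (∀ A : ℝ, 0 < A → ∃ C : ℝ, 0 < C ∧
      ∀ (n p : ℕ), 0 < p → (p : ℝ) ≤ γ * n →
      ∀ (σ : Fin p → ℝ), (∀ k, 0 < σ k) →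
      ∀ (P : Matrix (Fin p) (Fin p) ℝ), P ∈ Matrix.orthogonalGroup (Fin p) ℝ →
      ∀ (Ω : Type*) [MeasurableSpace Ω] (μ : Measure Ω) [IsProbabilityMeasure μ]
        (N : Ω → Matrix (Fin n) (Fin p) ℝ), MinVarPortfolio.IsStdGaussianMatrix μ N →
        1 - Real.exp (-(A * p)) ≤ μ.real {ω |
          IsUnit (MinVarPortfolio.sampleCov (MinVarPortfolio.dataMatrix σ P (N ω))).det ∧
          ‖MinVarPortfolio.freeWeight
                (MinVarPortfolio.sampleCov (MinVarPortfolio.dataMatrix σ P (N ω)))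
              - MinVarPortfolio.freeWeight (MinVarPortfolio.trueCov σ P)‖
            ≤ C * (‖MinVarPortfolio.freeWeight (MinVarPortfolio.trueCov σ P)‖
                * MinVarPortfolio.sigmaRatio σ * Real.sqrt ((p : ℝ) / n))}) ∧
    -- bound with probability at least `1 - n ^ (-c)`, as soon as `p ≥ a log n`
    (∀ a c : ℝ, 0 < a → 0 < c → ∃ C : ℝ, 0 < C ∧
      ∀ (n p : ℕ), 0 < p → (p : ℝ) ≤ γ * n → a * Real.log n ≤ p →
      ∀ (σ : Fin p → ℝ), (∀ k, 0 < σ k) →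
      ∀ (P : Matrix (Fin p) (Fin p) ℝ), P ∈ Matrix.orthogonalGroup (Fin p) ℝ →
      ∀ (Ω : Type*) [MeasurableSpace Ω] (μ : Measure Ω) [IsProbabilityMeasure μ]
        (N : Ω → Matrix (Fin n) (Fin p) ℝ), MinVarPortfolio.IsStdGaussianMatrix μ N →
        1 - (n : ℝ) ^ (-c) ≤ μ.real {ω |
          IsUnit (MinVarPortfolio.sampleCov (MinVarPortfolio.dataMatrix σ P (N ω))).det ∧
          ‖MinVarPortfolio.freeWeight
                (MinVarPortfolio.sampleCov (MinVarPortfolio.dataMatrix σ P (N ω)))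
              - MinVarPortfolio.freeWeight (MinVarPortfolio.trueCov σ P)‖
            ≤ C * (‖MinVarPortfolio.freeWeight (MinVarPortfolio.trueCov σ P)‖
                * MinVarPortfolio.sigmaRatio σ * Real.sqrt ((p : ℝ) / n))}) ∧
    -- bounds in expectation
    (∃ (C : ℝ) (n₀ : ℕ), 0 < C ∧
      ∀ (n p : ℕ), n₀ ≤ n → 0 < p → (p : ℝ) ≤ γ * n →
      ∀ (σ : Fin p → ℝ), (∀ k, 0 < σ k) →
      ∀ (P : Matrix (Fin p) (Fin p) ℝ), P ∈ Matrix.orthogonalGroup (Fin p) ℝ →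
      ∀ (Ω : Type*) [MeasurableSpace Ω] (μ : Measure Ω) [IsProbabilityMeasure μ]
        (N : Ω → Matrix (Fin n) (Fin p) ℝ), MinVarPortfolio.IsStdGaussianMatrix μ N →
        (∀ᵐ ω ∂μ,
          IsUnit (MinVarPortfolio.sampleCov (MinVarPortfolio.dataMatrix σ P (N ω))).det) ∧
        Integrable (fun ω => ‖MinVarPortfolio.freeWeight
              (MinVarPortfolio.sampleCov (MinVarPortfolio.dataMatrix σ P (N ω)))
            - MinVarPortfolio.freeWeight (MinVarPortfolio.trueCov σ P)‖) μ ∧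
        (∫ ω, ‖MinVarPortfolio.freeWeight
              (MinVarPortfolio.sampleCov (MinVarPortfolio.dataMatrix σ P (N ω)))
            - MinVarPortfolio.freeWeight (MinVarPortfolio.trueCov σ P)‖ ∂μ)
          ≤ C * (‖MinVarPortfolio.freeWeight (MinVarPortfolio.trueCov σ P)‖
              * MinVarPortfolio.sigmaRatio σ * Real.sqrt ((p : ℝ) / n)) ∧
        (∫ ω, ‖MinVarPortfolio.freeWeight
              (MinVarPortfolio.sampleCov (MinVarPortfolio.dataMatrix σ P (N ω)))
            - MinVarPortfolio.freeWeight (MinVarPortfolio.trueCov σ P)‖ ∂μ)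
          ≤ C * ((⨅ k, σ k) ^ (-2 : ℤ)
              * (p * MinVarPortfolio.sigmaRatio σ * Real.sqrt ((p : ℝ) / n)))) := by
  refine ⟨fun A hA => MinVarPortfolio.exists_forall_one_sub_exp_le_measureReal hγ0 hγ1 hA, fun a c ha hc => ?_, ?_⟩
  · obtain ⟨C, hC, h⟩ := MinVarPortfolio.exists_forall_one_sub_exp_le_measureReal hγ0 hγ1 (div_pos hc ha)
    refine ⟨C, hC, fun n p hp hpn hlog σ hσ P hP Ω _ μ _ N hN => ?_⟩
    refine le_trans ?_ (h n p hp hpn σ hσ P hP Ω μ N hN)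
    have hn : (0 : ℝ) < n := by
      exact_mod_cast hp.trans_le (MinVarPortfolio.le_of_le_mul hγ1 hpn)
    rw [Real.rpow_def_of_pos hn]
    gcongr
    have : c * Real.log n ≤ c / a * p := by
      rw [div_mul_eq_mul_div, le_div_iff₀ ha]
      nlinarith
    linarith
  · have ht := MinVarPortfolio.threshold_pos (γ := γ) one_pos
    set C := 513 * (MinVarPortfolio.threshold γ 1 ^ 8)⁻¹ + 144 * (4 * Real.exp 5) with hC
    have hC0 : 0 < C := by positivity
    refine ⟨C, ⌈12 / (1 - γ)⌉₊, hC0, fun n p hn hp hpn σ hσ P hP Ω _ μ _ N hN => ?_⟩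
    have hn' : 12 ≤ (1 - γ) * n := by
      rw [mul_comm, ← div_le_iff₀ (by linarith)]
      exact Nat.ceil_le.1 hn
    have hn0 : 0 < n := hp.trans_le (MinVarPortfolio.le_of_le_mul hγ1 hpn)
    have hlaw := hN.hasLaw
    have hr := MinVarPortfolio.sigmaRatio_nonneg hσ
    have hae : ∀ᵐ ω ∂μ,
        IsUnit (MinVarPortfolio.sampleCov (MinVarPortfolio.dataMatrix σ P (N ω))).det := by
      have h1 := MinVarPortfolio.ae_exists_notMem_smallSingularSet hγ0 hγ1 hp hpn hn'
      rw [← hlaw.map_eq] at h1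
      filter_upwards [ae_of_ae_map hlaw.aemeasurable h1] with ω hω
      obtain ⟨k, hk⟩ := hω
      exact MinVarPortfolio.isUnit_det_sampleCov_dataMatrix hσ hP
        (MinVarPortfolio.isUnit_det_of_notMem hn0 (by positivity) hk)
    have hmeas := MinVarPortfolio.measurable_norm_freeWeight_sub (n := n) σ P
      (MinVarPortfolio.freeWeight (MinVarPortfolio.trueCov σ P))
    have hlin := MinVarPortfolio.lintegral_norm_freeWeight_sub_le hγ0 hγ1 hp hpn hn' hσ hP
    rw [← hlaw.map_eq, lintegral_map' hmeas.ennreal_ofReal.aemeasurable hlaw.aemeasurable] at hlin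
    have haem := (hmeas.comp_aemeasurable hlaw.aemeasurable).aestronglyMeasurable
    simp only [Function.comp_def, MinVarPortfolio.toMat_apply_eq] at haem hlin
    have hint := lintegral_ofReal_ne_top_iff_integrable haem
      (Filter.Eventually.of_forall fun _ => norm_nonneg _) |>.1
      (ne_top_of_le_ne_top ENNReal.ofReal_ne_top hlin)
    have hbound : (∫ ω, ‖MinVarPortfolio.freeWeight
              (MinVarPortfolio.sampleCov (MinVarPortfolio.dataMatrix σ P (N ω)))
            - MinVarPortfolio.freeWeight (MinVarPortfolio.trueCov σ P)‖ ∂μ)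
          ≤ C * (‖MinVarPortfolio.freeWeight (MinVarPortfolio.trueCov σ P)‖
              * MinVarPortfolio.sigmaRatio σ * Real.sqrt ((p : ℝ) / n)) := by
      rw [integral_eq_lintegral_of_nonneg_ae
        (Filter.Eventually.of_forall fun _ => norm_nonneg _) haem]
      exact ENNReal.toReal_le_of_le_ofReal (by positivity) hlin
    refine ⟨hae, hint, hbound, hbound.trans ?_⟩
    have hS := MinVarPortfolio.norm_freeWeight_trueCov_le hp hσ hP
    refine mul_le_mul_of_nonneg_left ?_ hC0.le
    rw [← mul_assoc, ← mul_assoc]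
    gcongr
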